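/- There exist a continuous function $R:(-1,0)\to(0,\infty)$ with $R(t)\to\infty$ as $t\uparrow 0$, a nonempty open subset $P$ of an infinite-dimensional real Banach space, and a family of functions $u_c(x,\theta,t)$, $c\in P$, $2\pi$-periodic in $\theta$, which is jointly continuous in $(c,x,\theta,t)$ for $c\in P$, $|x|<R(t)$, $-1<t<0$, such that the following holds. For $c\in P$ and $-1<t<0$ let $$M^c_t=\Big\{\big(x,\ (\sqrt{-2t}+u_c(x,\theta,t))\cos\theta,\ (\sqrt{-2t}+u_c(x,\theta,t))\sin\theta\big)\ :\ |x|<R(t),\ \theta\in\mathbb R\Big\}\subset\mathbb R^3,$$ the normal graph of $u_c(\cdot,t)$ over the part $|x|<R(t)$ of the shrinking cylinder $\mathbb R\times\mathbb S^1_{\sqrt{-2t}}$. 1. For every $c\in P$, $\sqrt{-2t}+u_c>0$ and $(M^c_t)_{-1<t<0}$ is a smooth (incomplete) mean curvature flow: the graphical parametrization is a smooth family of immersions whose normal velocity is the mean curvature vector. 2. For every $c\in P$ the flow is not a product: for no $t\in(-1,0)$ is $M^c_t$ of the form $(-R(t),R(t))\times\Sigma$ with $\Sigma\subset\mathbb R^2$.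 3. For every $c\in P$ the flow develops a singularity at time $0$ with singular set $\mathbb R\times\{0\}\subset\mathbb R^3$: the points $p\in\mathbb R^3$ such that the second fundamental form of the flow is unbounded in every neighborhood of $p$ as $t\uparrow0$ are exactly the points of the line $\mathbb R\times\{0\}$. 4. The family is infinite-dimensional: besides being parametrized continuously by $P$, it satisfies that for $c\neq c'$ in $P$ there are times $t<0$ arbitrarily close to $0$ with $M^c_t\neq M^{c'}_t$. -/

import Mathlib

open Set Filter Topology
open scoped ContDiff

noncomputable section

/-- Euclidean three-space. -/
abbrev E3 : Type := EuclideanSpace ℝ (Fin 3)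

/-- Partial derivatives of a map of two real variables. -/
def pd (i : Fin 2) (F : ℝ → ℝ → E3) (x θ : ℝ) : E3 :=
  if i = 0 then deriv (fun y => F y θ) x else deriv (fun η => F x η) θ

/-- The metric `g i j = ⟪∂ᵢF, ∂ⱼF⟫` induced by a parametrized surface `F`. -/
def firstForm (F : ℝ → ℝ → E3) (x θ : ℝ) : Matrix (Fin 2) (Fin 2) ℝ :=
  Matrix.of fun i j => inner ℝ (pd i F x θ) (pd j F x θ)

/-- The tangent plane of a parametrized surface. -/
def tangentPlane (F : ℝ → ℝ → E3) (x θ : ℝ) : Submodule ℝ E3 :=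
  Submodule.span ℝ (range fun i => pd i F x θ)

/-- The component of `v` normal to a parametrized surface. -/
def normalPart (F : ℝ → ℝ → E3) (x θ : ℝ) (v : E3) : E3 :=
  (tangentPlane F x θ)ᗮ.starProjection v

/-- The (vector valued) second fundamental form `A i j = (∂ᵢ∂ⱼF)^⊥`. -/
def secondForm (F : ℝ → ℝ → E3) (x θ : ℝ) (i j : Fin 2) : E3 :=
  normalPart F x θ (pd i (pd j F) x θ)

/-- The mean curvature vector `gⁱʲ Aᵢⱼ`. -/
def meanCurvatureVector (F : ℝ → ℝ → E3) (x θ : ℝ) : E3 :=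
  ∑ i, ∑ j, (firstForm F x θ)⁻¹ i j • secondForm F x θ i j

/-- The squared norm `|A|² = gⁱᵏ gʲˡ ⟪Aᵢⱼ, Aₖₗ⟫` of the second fundamental form. -/
def normSqSecondForm (F : ℝ → ℝ → E3) (x θ : ℝ) : ℝ :=
  ∑ i, ∑ j, ∑ k, ∑ l, (firstForm F x θ)⁻¹ i k * (firstForm F x θ)⁻¹ j l *
    inner ℝ (secondForm F x θ i j) (secondForm F x θ k l)

/-- `F` (with space parameters `x`, `θ` and time `t`) is a smooth mean curvature flow of immersed
surfaces on the set `D` of parameters `(x, θ, t)`. As `D` need not be a product of a surface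
and a time interval, and as graphical parametrizations move tangentially, the equation is
imposed on the normal velocity: `(∂ₜF)^⊥ = H`. -/
structure IsMeanCurvatureFlow (F : ℝ → ℝ → ℝ → E3) (D : Set (ℝ × ℝ × ℝ)) : Prop where
  smooth : ContDiffOn ℝ ∞ (fun q : ℝ × ℝ × ℝ => F q.1 q.2.1 q.2.2) D
  immersion : ∀ x θ t, (x, θ, t) ∈ D →
    LinearIndependent ℝ fun i => pd i (fun y η => F y η t) x θ
  evolution : ∀ x θ t, (x, θ, t) ∈ D →
    normalPart (fun y η => F y η t) x θ (deriv (fun s => F x θ s) t) =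
      meanCurvatureVector (fun y η => F y η t) x θ

/-- The singular set at time `0`: the points near which the second fundamental form
is unbounded as `t ↑ 0`. -/
def singularSet (F : ℝ → ℝ → ℝ → E3) (D : Set (ℝ × ℝ × ℝ)) : Set E3 :=
  {p | ∀ C : ℝ, ∀ ε > 0, ∃ x θ t, (x, θ, t) ∈ D ∧ -ε < t ∧ t < 0 ∧
    dist (F x θ t) p < ε ∧ C < normSqSecondForm (fun y η => F y η t) x θ}

/-- The normal graph of `u` over the shrinking cylinders `ℝ × S¹` of radius `√(-2t)`; the point
`(x, √(-2t) e^{iθ})` of the cylinder is moved by `u x θ t` along the outward normal. -/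
def cylGraph (u : ℝ → ℝ → ℝ → ℝ) (x θ t : ℝ) : E3 :=
  !₂[x, (√(-2 * t) + u x θ t) * Real.cos θ, (√(-2 * t) + u x θ t) * Real.sin θ]

/-- The space-time region `|x| < R t`, `-1 < t < 0`, in coordinates `(x, θ, t)`. -/
def region (R : ℝ → ℝ) : Set (ℝ × ℝ × ℝ) :=
  {q | q.2.2 ∈ Ioo (-1 : ℝ) 0 ∧ |q.1| < R q.2.2}

/-- The surface at time `t` of the local graph of `u`. -/
def slice (R : ℝ → ℝ) (u : ℝ → ℝ → ℝ → ℝ) (t : ℝ) : Set E3 :=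
  {p | ∃ x θ, |x| < R t ∧ p = cylGraph u x θ t}

/-- The local graph of `u` over the part `|x| < R t` of the shrinking cylinders is a mean
curvature flow for `-1 < t < 0`. -/
structure IsLocalGraphFlow (R : ℝ → ℝ) (u : ℝ → ℝ → ℝ → ℝ) : Prop where
  periodic : ∀ x θ t, u x (θ + 2 * Real.pi) t = u x θ t
  radius_pos : ∀ x θ t, (x, θ, t) ∈ region R → 0 < √(-2 * t) + u x θ t
  flow : IsMeanCurvatureFlow (cylGraph u) (region R)

/-- The surface at time `t` is a product of the interval `|x| < R t` and a set `S`
in the plane. -/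
def IsProductSlice (R : ℝ → ℝ) (u : ℝ → ℝ → ℝ → ℝ) (t : ℝ) : Prop :=
  ∃ S : Set (ℝ × ℝ), slice R u t = {p | |p 0| < R t ∧ (p 1, p 2) ∈ S}

/-- The line `ℝ × {0}` in `ℝ³`, the axis of the cylinders. -/
def axis : Set E3 := {p | p 1 = 0 ∧ p 2 = 0}

/-- A family `u c`, `c ∈ P`, of flows given as local graphs is infinite-dimensional: `P` is a
nonempty open subset of an infinite-dimensional Banach space, the flows depend continuously
on `c`, and different parameters give flows that differ at times arbitrarily close to `0`. -/
structure IsInfiniteDimensionalFamily {E : Type} [NormedAddCommGroup E] [NormedSpace ℝ E]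
    (R : ℝ → ℝ) (P : Set E) (u : E → ℝ → ℝ → ℝ → ℝ) : Prop where
  complete : CompleteSpace E
  infinite_dim : ¬ FiniteDimensional ℝ E
  isOpen : IsOpen P
  nonempty : P.Nonempty
  continuous : ContinuousOn (fun q : E × ℝ × ℝ × ℝ => u q.1 q.2.1 q.2.2.1 q.2.2.2)
    (P ×ˢ region R)
  injective : ∀ c ∈ P, ∀ c' ∈ P, c ≠ c' → ∀ ε > 0, ∃ t ∈ Ioo (-1 : ℝ) 0,
    -ε < t ∧ slice R (u c) t ≠ slice R (u c') t

end

/-! For a surface of revolution of radius `√v`, `v = -2t + w`, mean curvature flow is the scalar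
equation `w_xx = w_t + w_x² (w_t + 2) / (4v)`. It is solved sideways, in the manner of Tychonoff's
solutions of the heat equation: `x` plays the role of time, with `w = 0` and `w_x = h(t)` on `x =
0`. In the unknowns `q = w_x`, `a = w_t`, `p = 1/v` this is a first-order system with polynomial
nonlinearity, and `h` determines its power series solution in `x` (`exists_formalSolution`).

The data are `h(t) = exp(-M/t⁴) (2 + ∑ cⱼ (t/4)ʲ)` with `c` in the unit ball of `ℓ^∞`: analytic for
`-1 < t < 0`, with radius comparable to `-t`, and flat at `0`. The difficulty is convergence for
`|x| < 1/√(-t)`, far beyond the parabolic scale `√(-t)`. At a fixed `t` the solution is majorized by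
multiples of `φ(αx + βs)`, where `β = 16/(-t)` comes from Cauchy's estimates and `α = √(-t)/8` from
the desired width. Catalan coefficients make `φ` stable under products. The equation for `q`
moreover needs `α² φ'` to dominate about `(β + α²) φ`, which fails for the plain Catalan series.
Weights with `φ' ≥ N φ`, `N ≈ β/α² = 1024/t²`, repair this, at the price that the data be smaller by
a factor `N^(-N)`; since `N^N ≤ exp(N²)`, the factor `exp(-M/t⁴)` pays for it
(`FormalSolution.majorized`, `four_mul_exp_le`).

The resulting bounds give `-t ≤ v ≤ -3t` and a small slope, so the surfaces collapse onto the axis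
with `|A|² ≥ 1/(-6t)`, while their width tends to infinity (`singularSet_eq`). As `w_x(0, t) = h(t)
> 0`, no slice is a product. The slices determine `h`, and `h` near `t = 0` determines `c` by the
identity theorem. -/

/-! ### Recursion and binomial sums -/

/-- Existence of a sequence given by a course-of-values recursion. -/
theorem exists_seq_of_recursion {A : Type*} (a : A) (G : ℕ → (ℕ → A) → A)
    (hG : ∀ n S S', (∀ k ≤ n, S k = S' k) → G n S = G n S') :
    ∃ S : ℕ → A, S 0 = a ∧ ∀ n, S (n + 1) = G n S := by
  -- `T n` has its final values at all indices up to `n`, and later updates leave these alone; the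
  -- sequence is the diagonal.
  let T : ℕ → ℕ → A := fun n => Nat.rec (fun _ => a)
    (fun m S => Function.update S (m + 1) (G m S)) n
  have hT : ∀ m, T (m + 1) = Function.update (T m) (m + 1) (G m (T m)) := fun m => rfl
  have stable : ∀ k d, T (k + d) k = T k k := by
    intro k d
    induction d with
    | zero => rfl
    | succ d ih =>
      rw [← add_assoc, hT, Function.update_of_ne (by omega), ih]
  refine ⟨fun n => T n n, rfl, fun n => ?_⟩
  change T (n + 1) (n + 1) = _
  rw [hT, Function.update_self]
  refine hG n _ _ fun k hk => ?_
  obtain ⟨d, rfl⟩ := Nat.exists_eq_add_of_le hk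
  exact stable k d

/-- Pascal's rule under the sum; it is the induction step of the Vandermonde identity below. -/
theorem sum_range_choose_succ_mul (k : ℕ) (H : ℕ → ℝ) :
    ∑ i ∈ Finset.range (k + 2), ((k + 1).choose i : ℝ) * H i =
      ∑ i ∈ Finset.range (k + 1), (k.choose i : ℝ) * (H i + H (i + 1)) := by
  simp only [mul_add, Finset.sum_add_distrib]
  rw [Finset.sum_range_succ', Finset.sum_congr rfl fun i _ => by
    rw [Nat.choose_succ_succ, Nat.cast_add, add_mul], Finset.sum_add_distrib,
    Finset.sum_range_succ' (fun i => (k.choose i : ℝ) * H i),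
    Finset.sum_range_succ (fun i => (k.choose (i + 1) : ℝ) * H (i + 1)) k]
  simp
  ring

/-- A form of the Vandermonde identity. -/
theorem sum_choose_mul_choose (k j : ℕ) (G : ℕ → ℝ) :
    ∑ i ∈ Finset.range (k + 1), ∑ l ∈ Finset.range (j + 1),
      (k.choose i : ℝ) * ((j.choose l : ℝ) * G (i + l)) =
    ∑ n ∈ Finset.range (k + j + 1), ((k + j).choose n : ℝ) * G n := by
  induction k generalizing G with
  | zero => simp
  | succ k ih =>
    simp only [← Finset.mul_sum] at ih ⊢
    rw [sum_range_choose_succ_mul k fun i => ∑ l ∈ Finset.range (j + 1), (j.choose l : ℝ) * G (i + l)]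
    have e := ih fun n => G n + G (n + 1)
    rw [show k + 1 + j = k + j + 1 by omega, sum_range_choose_succ_mul, ← e]
    refine Finset.sum_congr rfl fun i _ => ?_
    rw [← Finset.sum_add_distrib]
    congr 1
    refine Finset.sum_congr rfl fun l _ => ?_
    rw [show i + 1 + l = i + l + 1 by omega]
    ring

/-! ### Majorants in two variables -/

/-- The coefficients up to order `n` of the power series `f = ∑ fₖ(t) xᵏ` are smooth at `t` and,
with all their derivatives, are dominated by the Taylor coefficients of `φ (α x + β s)` at
`(x, s) = 0`. -/
def Majorized (t α β : ℝ) (n : ℕ) (f : PowerSeries (ℝ → ℝ)) (φ : PowerSeries ℝ) : Prop :=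
  ∀ k ≤ n, ContDiffAt ℝ ∞ (f.coeff k) t ∧ ∀ j,
    |iteratedDeriv j (f.coeff k) t| * k.factorial ≤
      α ^ k * β ^ j * (k + j).factorial * φ.coeff (k + j)

namespace Majorized

variable {t α β : ℝ} {n : ℕ} {f g : PowerSeries (ℝ → ℝ)} {φ γ : PowerSeries ℝ}

theorem add (hf : Majorized t α β n f φ) (hg : Majorized t α β n g γ) :
    Majorized t α β n (f + g) (φ + γ) := by
  intro k hk
  refine ⟨by rw [map_add]; exact (hf k hk).1.add (hg k hk).1, fun j => ?_⟩
  rw [map_add, map_add, iteratedDeriv_add ((hf k hk).1.of_le (by exact_mod_cast le_top))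
    ((hg k hk).1.of_le (by exact_mod_cast le_top)), mul_add]
  refine (mul_le_mul_of_nonneg_right (abs_add_le _ _) (by positivity)).trans ?_
  rw [add_mul]
  exact add_le_add ((hf k hk).2 j) ((hg k hk).2 j)

theorem smul (hf : Majorized t α β n f φ) (r : ℝ) : Majorized t α β n (r • f) (|r| • φ) := by
  intro k hk
  have e : (r • f).coeff k = r • f.coeff k := rfl
  refine ⟨e ▸ (hf k hk).1.const_smul r, fun j => ?_⟩
  rw [e, iteratedDeriv_const_smul_field, smul_eq_mul, abs_mul, mul_assoc]
  refine (mul_le_mul_of_nonneg_left ((hf k hk).2 j) (abs_nonneg r)).trans (le_of_eq ?_)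
  rw [PowerSeries.coeff_smul, smul_eq_mul]
  ring

theorem one : Majorized t α β n 1 1 := by
  intro k _
  rcases k with _ | k
  · refine ⟨by rw [PowerSeries.coeff_zero_one]; exact contDiffAt_const, fun j => ?_⟩
    rcases j with _ | j
    · simp
    · simp only [PowerSeries.coeff_zero_one, Nat.zero_add]
      rw [show (1 : ℝ → ℝ) = fun _ => 1 from rfl, iteratedDeriv_const]
      simp [PowerSeries.coeff_one]
  · have e : PowerSeries.coeff (k + 1) (1 : PowerSeries (ℝ → ℝ)) = fun _ => 0 := by
      simp [PowerSeries.coeff_one]; rfl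
    refine ⟨e ▸ contDiffAt_const, fun j => ?_⟩
    rw [e, iteratedDeriv_const, PowerSeries.coeff_one, if_neg (by omega : k + 1 + j ≠ 0)]
    simp

/-- The Cauchy product in `x` and the Leibniz rule in `t` give a double binomial sum. The bounds for
the factors depend on the orders `i` and `l` only through `i + l`, apart from powers of `α` and `β`,
so the Vandermonde identity collapses it to the Cauchy product of `φ` and `γ`. -/
theorem mul (hf : Majorized t α β n f φ)
    (hg : Majorized t α β n g γ) : Majorized t α β n (f * g) (φ * γ) := by
  intro k hk
  have e : (f * g).coeff k = ∑ i ∈ Finset.range (k + 1), f.coeff i * g.coeff (k - i) := by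
    rw [PowerSeries.coeff_mul, Finset.Nat.sum_antidiagonal_eq_sum_range_succ
      (fun i j => f.coeff i * g.coeff j)]
  have sf : ∀ i ≤ k, ContDiffAt ℝ ∞ (f.coeff i) t := fun i hi => (hf i (hi.trans hk)).1
  have sg : ∀ i ≤ k, ContDiffAt ℝ ∞ (g.coeff i) t := fun i hi => (hg i (hi.trans hk)).1
  have sp : ∀ i ∈ Finset.range (k + 1), ContDiffAt ℝ ∞ (f.coeff i * g.coeff (k - i)) t :=
    fun i hi => (sf i (by simp at hi; omega)).mul (sg _ (by omega))
  refine ⟨by rw [e, Finset.sum_fn]; exact ContDiffAt.sum sp, fun j => ?_⟩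
  have hle : ((j : ℕ∞) : WithTop ℕ∞) ≤ ∞ := by exact_mod_cast le_top
  rw [e, iteratedDeriv_sum fun i hi => (sp i hi).of_le hle, PowerSeries.coeff_mul,
    Finset.Nat.sum_antidiagonal_eq_sum_range_succ (fun i j => φ.coeff i * γ.coeff j)]
  have key : ∀ i ∈ Finset.range (k + 1), ∀ l ∈ Finset.range (j + 1),
      |(j.choose l : ℝ) * iteratedDeriv l (f.coeff i) t * iteratedDeriv (j - l) (g.coeff (k - i)) t|
        * k.factorial ≤ (k.choose i : ℝ) * ((j.choose l : ℝ) * (α ^ k * β ^ j *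
          ((i + l).factorial * φ.coeff (i + l) *
          ((k + j - (i + l)).factorial * γ.coeff (k + j - (i + l)))))) := by
    intro i hi l hl
    simp only [Finset.mem_range] at hi hl
    have h1 := (hf i (by omega)).2 l
    have h2 := (hg (k - i) (by omega)).2 (j - l)
    have h3 := mul_le_mul h1 h2 (by positivity) (le_trans (by positivity) h1)
    rw [abs_mul, abs_mul, Nat.abs_cast, ← Nat.choose_mul_factorial_mul_factorial (by omega : i ≤ k)]
    rw [show k + j - (i + l) = k - i + (j - l) by omega]
    have ha : α ^ k = α ^ i * α ^ (k - i) := by rw [← pow_add]; congr 1; omega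
    have hb : β ^ j = β ^ l * β ^ (j - l) := by rw [← pow_add]; congr 1; omega
    rw [ha, hb]
    push_cast
    calc _ = ((k.choose i : ℝ) * (j.choose l : ℝ)) * (|iteratedDeriv l (f.coeff i) t| * i.factorial *
          (|iteratedDeriv (j - l) (g.coeff (k - i)) t| * (k - i).factorial)) := by ring
      _ ≤ ((k.choose i : ℝ) * (j.choose l : ℝ)) * _ :=
          mul_le_mul_of_nonneg_left h3 (by positivity)
      _ = _ := by ring
  calc _ ≤ ∑ i ∈ Finset.range (k + 1), ∑ l ∈ Finset.range (j + 1),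
        |(j.choose l : ℝ) * iteratedDeriv l (f.coeff i) t *
          iteratedDeriv (j - l) (g.coeff (k - i)) t| * k.factorial := by
        simp only [← Finset.sum_mul]
        refine mul_le_mul_of_nonneg_right ?_ (by positivity)
        refine (Finset.abs_sum_le_sum_abs _ _).trans (Finset.sum_le_sum fun i hi => ?_)
        rw [iteratedDeriv_mul ((sf i (by simp at hi; omega)).of_le hle)
          ((sg _ (by omega)).of_le hle)]
        exact Finset.abs_sum_le_sum_abs _ _
    _ ≤ _ := Finset.sum_le_sum fun i hi => Finset.sum_le_sum fun l hl => key i hi l hl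
    _ = _ := by
        rw [sum_choose_mul_choose k j fun n => α ^ k * β ^ j * (n.factorial * φ.coeff n *
          ((k + j - n).factorial * γ.coeff (k + j - n))), Finset.mul_sum]
        refine Finset.sum_congr rfl fun n hn => ?_
        rw [← Nat.choose_mul_factorial_mul_factorial (by simp at hn; omega : n ≤ k + j)]
        push_cast
        ring

/-- Integration in `x`: when `∂ₓ f = G`, the bound on `G` passes to the next coefficient of `f` as
soon as `γ ≤ α φ'` coefficientwise. -/
theorem succ (hα : 0 ≤ α) (hβ : 0 ≤ β) {G : PowerSeries (ℝ → ℝ)} (hf : Majorized t α β n f φ)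
    (hG : Majorized t α β n G γ) (e : f.coeff (n + 1) = ((n + 1 : ℝ)⁻¹) • G.coeff n)
    (h : ∀ m, γ.coeff m ≤ α * ((m + 1) * φ.coeff (m + 1))) : Majorized t α β (n + 1) f φ := by
  intro k hk
  rcases Nat.lt_or_ge k (n + 1) with hk' | hk'
  · exact hf k (by omega)
  obtain rfl : k = n + 1 := le_antisymm hk hk'
  obtain ⟨hs, hb⟩ := hG n le_rfl
  refine ⟨by rw [e]; exact contDiffAt_const.smul hs, fun j => ?_⟩
  have hn : (0 : ℝ) < n + 1 := by positivity
  rw [e, iteratedDeriv_const_smul_field, smul_eq_mul, abs_mul, abs_of_pos (inv_pos.2 hn),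
    Nat.factorial_succ, show n + 1 + j = (n + j) + 1 by omega, Nat.factorial_succ, pow_succ]
  push_cast
  have h1 := mul_le_mul_of_nonneg_left (h (n + j))
    (by positivity : 0 ≤ α ^ n * β ^ j * (n + j).factorial)
  push_cast at h1
  calc _ = |iteratedDeriv j (G.coeff n) t| * n.factorial := by field_simp
    _ ≤ _ := (hb j).trans h1
    _ = _ := by ring

end Majorized

/-! ### Weighted Catalan series -/

section Catalan

theorem succ_succ_mul_catalan_succ (n : ℕ) :
    (n + 2) * catalan (n + 1) = (4 * n + 2) * catalan n := by
  have h1 := succ_mul_catalan_eq_centralBinom n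
  have h2 := succ_mul_catalan_eq_centralBinom (n + 1)
  have h3 := Nat.succ_mul_centralBinom_succ n
  rw [← h1, ← h2] at h3
  refine Nat.eq_of_mul_eq_mul_left (Nat.succ_pos n) ?_
  rw [Nat.succ_eq_add_one]
  linarith

theorem catalan_succ_le (n : ℕ) : catalan (n + 1) ≤ 4 * catalan n := by
  have h := succ_succ_mul_catalan_succ n
  nlinarith

theorem catalan_le_succ (n : ℕ) : catalan n ≤ catalan (n + 1) := by
  have h := succ_succ_mul_catalan_succ n
  nlinarith

theorem one_le_catalan (n : ℕ) : 1 ≤ catalan n := by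
  induction n with
  | zero => simp
  | succ n ih => exact ih.trans (catalan_le_succ n)

theorem catalan_le_four_pow (n : ℕ) : catalan n ≤ 4 ^ n := by
  induction n with
  | zero => simp
  | succ n ih => rw [pow_succ]; linarith [catalan_succ_le n]

/-- The generating function of the Catalan numbers. -/
noncomputable def catSeries : PowerSeries ℝ := PowerSeries.mk fun n => (catalan n : ℝ)

/-- The increasing weights `N ^ (min n N - N)`. -/
noncomputable def weight (N n : ℕ) : ℝ := (N : ℝ) ^ (min n N) / (N : ℝ) ^ N

/-- The weighted generating function of the Catalan numbers. -/
noncomputable def wcatSeries (N : ℕ) : PowerSeries ℝ :=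
  PowerSeries.mk fun n => weight N n * (catalan n : ℝ)

variable {N : ℕ}

theorem weight_nonneg (n : ℕ) : 0 ≤ weight N n := by unfold weight; positivity

theorem weight_mono (hN : 1 ≤ N) : Monotone (weight N) := by
  intro m n hmn
  have hN' : (1 : ℝ) ≤ N := by exact_mod_cast hN
  unfold weight
  gcongr

theorem weight_le_one (hN : 1 ≤ N) (n : ℕ) : weight N n ≤ 1 := by
  have hN' : (1 : ℝ) ≤ N := by exact_mod_cast hN
  unfold weight
  exact div_le_one_of_le₀ (pow_le_pow_right₀ hN' (min_le_right _ _)) (by positivity)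

/-- Below index `N` the weight itself grows by the factor `N`; from there on it is constant and `n +
1 ≥ N` does the work. -/
theorem mul_weight_le (hN : 1 ≤ N) (n : ℕ) : N * weight N n ≤ (n + 1) * weight N (n + 1) := by
  rcases Nat.lt_or_ge n N with h | h
  · have e : weight N (n + 1) = N * weight N n := by
      unfold weight
      rw [min_eq_left (by omega), min_eq_left (by omega), pow_succ]
      ring
    rw [e]
    nlinarith [mul_nonneg (Nat.cast_nonneg (α := ℝ) n)
      (mul_nonneg (Nat.cast_nonneg (α := ℝ) N) (weight_nonneg (N := N) n))]
  · have h' : (N : ℝ) ≤ n + 1 := by exact_mod_cast h.trans (Nat.le_succ n)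
    exact mul_le_mul h' (weight_mono hN (Nat.le_succ n)) (weight_nonneg n) (by positivity)

/-- Coefficientwise order of real power series. -/
def CoeffLE (φ γ : PowerSeries ℝ) : Prop := ∀ m, φ.coeff m ≤ γ.coeff m

theorem CoeffLE.trans {φ γ χ : PowerSeries ℝ} (h : CoeffLE φ γ) (h' : CoeffLE γ χ) :
    CoeffLE φ χ := fun m => (h m).trans (h' m)

theorem CoeffLE.smul {φ γ : PowerSeries ℝ} (h : CoeffLE φ γ) {r : ℝ} (hr : 0 ≤ r) :
    CoeffLE (r • φ) (r • γ) := fun m => by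
  simpa using mul_le_mul_of_nonneg_left (h m) hr

theorem CoeffLE.mul_left {φ γ χ : PowerSeries ℝ} (h : CoeffLE φ γ) (hχ : CoeffLE 0 χ) :
    CoeffLE (χ * φ) (χ * γ) := fun m => by
  rw [PowerSeries.coeff_mul, PowerSeries.coeff_mul]
  exact Finset.sum_le_sum fun p _ => mul_le_mul_of_nonneg_left (h _) (by simpa using hχ p.1)

theorem coeffLE_catSeries : CoeffLE 0 catSeries := fun m => by simp [catSeries]

theorem coeffLE_wcatSeries : CoeffLE 0 (wcatSeries N) := fun m => by
  simpa [wcatSeries] using mul_nonneg (weight_nonneg (N := N) m) (Nat.cast_nonneg _)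

theorem wcatSeries_le (hN : 1 ≤ N) : CoeffLE (wcatSeries N) catSeries := fun m => by
  simpa [wcatSeries, catSeries] using
    mul_le_mul_of_nonneg_right (weight_le_one hN m) (Nat.cast_nonneg (catalan m))

/-- The square of the Catalan series is its own shift, and `catalan (m + 1) ≤ 4 * catalan m`. A
weight that increases can be pulled out of the convolution at its top index. -/
theorem wcatSeries_mul_catSeries_le (hN : 1 ≤ N) :
    CoeffLE (wcatSeries N * catSeries) ((4 : ℝ) • wcatSeries N) := fun m => by
  have h1 : (catalan (m + 1) : ℝ) ≤ 4 * catalan m := by exact_mod_cast catalan_succ_le m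
  rw [catalan_succ'] at h1
  push_cast at h1
  rw [PowerSeries.coeff_mul]
  simp only [wcatSeries, catSeries, PowerSeries.coeff_smul, PowerSeries.coeff_mk, smul_eq_mul]
  calc _ ≤ ∑ p ∈ Finset.HasAntidiagonal.antidiagonal m, weight N m * ((catalan p.1 : ℝ) * catalan p.2) := by
        refine Finset.sum_le_sum fun p hp => ?_
        rw [mul_assoc]
        exact mul_le_mul_of_nonneg_right
          (weight_mono hN (Finset.HasAntidiagonal.antidiagonal.fst_le hp)) (by positivity)
    _ = weight N m * ∑ p ∈ Finset.HasAntidiagonal.antidiagonal m, ((catalan p.1 : ℝ) * catalan p.2) := by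
        rw [Finset.mul_sum]
    _ ≤ weight N m * (4 * catalan m) := mul_le_mul_of_nonneg_left h1 (weight_nonneg m)
    _ = _ := by ring

theorem wcatSeries_mul_self_le (hN : 1 ≤ N) :
    CoeffLE (wcatSeries N * wcatSeries N) ((4 : ℝ) • wcatSeries N) :=
  ((wcatSeries_le hN).mul_left coeffLE_wcatSeries).trans (wcatSeries_mul_catSeries_le hN)

theorem wcatSeries_sq_mul_catSeries_le (hN : 1 ≤ N) :
    CoeffLE (wcatSeries N * (wcatSeries N * catSeries)) ((16 : ℝ) • wcatSeries N) := by
  refine ((wcatSeries_mul_catSeries_le hN).mul_left coeffLE_wcatSeries).trans ?_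
  rw [mul_smul_comm, show (16 : ℝ) = 4 * 4 by norm_num, mul_smul]
  exact (wcatSeries_mul_self_le hN).smul (by norm_num)

theorem wcatSeries_cube_mul_catSeries_le (hN : 1 ≤ N) :
    CoeffLE (wcatSeries N * (wcatSeries N * (wcatSeries N * catSeries)))
      ((64 : ℝ) • wcatSeries N) := by
  refine ((wcatSeries_sq_mul_catSeries_le hN).mul_left coeffLE_wcatSeries).trans ?_
  rw [mul_smul_comm, show (64 : ℝ) = 16 * 4 by norm_num, mul_smul]
  exact (wcatSeries_mul_self_le hN).smul (by norm_num)

theorem catSeries_sq_mul_wcatSeries_le (hN : 1 ≤ N) :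
    CoeffLE (catSeries * (catSeries * wcatSeries N)) ((16 : ℝ) • wcatSeries N) := by
  have h := wcatSeries_mul_catSeries_le hN
  rw [mul_comm] at h
  refine (h.mul_left coeffLE_catSeries).trans ?_
  rw [mul_smul_comm, show (16 : ℝ) = 4 * 4 by norm_num, mul_smul]
  exact h.smul (by norm_num)

/-- This is the purpose of the weights: `φ' ≥ N φ` coefficientwise. -/
theorem mul_coeff_wcatSeries_le (hN : 1 ≤ N) (m : ℕ) :
    N * (wcatSeries N).coeff m ≤ (m + 1) * (wcatSeries N).coeff (m + 1) := by
  simp only [wcatSeries, PowerSeries.coeff_mk]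
  have h : (catalan m : ℝ) ≤ catalan (m + 1) := by exact_mod_cast catalan_le_succ m
  rw [← mul_assoc, ← mul_assoc]
  exact mul_le_mul (mul_weight_le hN m) h (by positivity)
    (mul_nonneg (by positivity) (weight_nonneg _))

theorem coeff_catSeries_le (m : ℕ) :
    catSeries.coeff m ≤ (m + 1) * catSeries.coeff (m + 1) := by
  simp only [catSeries, PowerSeries.coeff_mk]
  have h : (catalan m : ℝ) ≤ catalan (m + 1) := by exact_mod_cast catalan_le_succ m
  nlinarith [mul_nonneg (Nat.cast_nonneg (α := ℝ) m) (Nat.cast_nonneg (α := ℝ) (catalan (m + 1)))]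

theorem coeff_catSeries_le_pow (m : ℕ) : catSeries.coeff m ≤ 4 ^ m := by
  simp only [catSeries, PowerSeries.coeff_mk]
  exact_mod_cast catalan_le_four_pow m

theorem coeff_wcatSeries_le_pow (hN : 1 ≤ N) (m : ℕ) : (wcatSeries N).coeff m ≤ 4 ^ m :=
  (wcatSeries_le hN m).trans (coeff_catSeries_le_pow m)

end Catalan

/-! ### The formal Cauchy problem and its majorants -/

/-- Power series in `x` (with functions of `t` as coefficients) solving the system
`∂ₓ q = a + q² (a + 2) p / 4`, `∂ₓ a = ∂ₜ q`, `∂ₓ p = -p² q` with `q = h`, `a = 0`,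
`p = -1 / (2 t)` at `x = 0`. For a function `w` of `(x, t)`, this is the equation of the evolution
by mean curvature of the surface of revolution of radius `√v`, `v = -2 t + w`, where `q = ∂ₓ w`,
`a = ∂ₜ w` and `p = 1 / v`. -/
structure FormalSolution (h : ℝ → ℝ) (q a p : PowerSeries (ℝ → ℝ)) : Prop where
  q_zero : q.coeff 0 = h
  a_zero : a.coeff 0 = fun _ => 0
  p_zero : p.coeff 0 = fun t => (-(1 / 2) : ℝ) * t⁻¹
  q_succ : ∀ n : ℕ, q.coeff (n + 1) =
    ((n + 1 : ℝ)⁻¹) • (a + (1 / 4 : ℝ) • (q * (q * ((a + (2 : ℝ) • 1) * p)))).coeff n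
  a_succ : ∀ n : ℕ, a.coeff (n + 1) = ((n + 1 : ℝ)⁻¹) • deriv (q.coeff n)
  p_succ : ∀ n : ℕ, p.coeff (n + 1) = ((n + 1 : ℝ)⁻¹) • ((-1 : ℝ) • (p * (p * q))).coeff n

theorem coeff_mul_congr {n : ℕ} {f f' g g' : PowerSeries (ℝ → ℝ)}
    (hf : ∀ k ≤ n, f.coeff k = f'.coeff k) (hg : ∀ k ≤ n, g.coeff k = g'.coeff k) :
    ∀ k ≤ n, (f * g).coeff k = (f' * g').coeff k := by
  intro k hk
  rw [PowerSeries.coeff_mul, PowerSeries.coeff_mul]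
  refine Finset.sum_congr rfl fun p hp => ?_
  rw [hf _ ((Finset.HasAntidiagonal.antidiagonal.fst_le hp).trans hk),
    hg _ ((Finset.HasAntidiagonal.antidiagonal.snd_le hp).trans hk)]

/-- The right-hand sides at order `n` involve only coefficients of order at most `n`, so the system
is a course-of-values recursion. -/
theorem exists_formalSolution (h : ℝ → ℝ) : ∃ q a p, FormalSolution h q a p := by
  let Q : (ℕ → (ℝ → ℝ) × (ℝ → ℝ) × (ℝ → ℝ)) → PowerSeries (ℝ → ℝ) :=
    fun S => PowerSeries.mk fun k => (S k).1
  let A : (ℕ → (ℝ → ℝ) × (ℝ → ℝ) × (ℝ → ℝ)) → PowerSeries (ℝ → ℝ) :=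
    fun S => PowerSeries.mk fun k => (S k).2.1
  let P : (ℕ → (ℝ → ℝ) × (ℝ → ℝ) × (ℝ → ℝ)) → PowerSeries (ℝ → ℝ) :=
    fun S => PowerSeries.mk fun k => (S k).2.2
  obtain ⟨S, h0, hS⟩ := exists_seq_of_recursion
    (h, (fun _ => (0 : ℝ)), fun t : ℝ => (-(1 / 2) : ℝ) * t⁻¹)
    (fun n S => (((n + 1 : ℝ)⁻¹) •
      (A S + (1 / 4 : ℝ) • (Q S * (Q S * ((A S + (2 : ℝ) • 1) * P S)))).coeff n,
      ((n + 1 : ℝ)⁻¹) • deriv ((Q S).coeff n),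
      ((n + 1 : ℝ)⁻¹) • ((-1 : ℝ) • (P S * (P S * Q S))).coeff n)) (by
    intro n S S' hSS
    have hQ : ∀ k ≤ n, (Q S).coeff k = (Q S').coeff k := fun k hk => by simp [Q, hSS k hk]
    have hA : ∀ k ≤ n, (A S).coeff k = (A S').coeff k := fun k hk => by simp [A, hSS k hk]
    have hP : ∀ k ≤ n, (P S).coeff k = (P S').coeff k := fun k hk => by simp [P, hSS k hk]
    have hA2 : ∀ k ≤ n, (A S + (2 : ℝ) • 1).coeff k = (A S' + (2 : ℝ) • 1).coeff k :=
      fun k hk => by rw [map_add, map_add, hA k hk]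
    have h1 := coeff_mul_congr hQ (coeff_mul_congr hQ (coeff_mul_congr hA2 hP)) n le_rfl
    have h2 := coeff_mul_congr hP (coeff_mul_congr hP hQ) n le_rfl
    have sm : ∀ (r : ℝ) (f : PowerSeries (ℝ → ℝ)), (r • f).coeff n = r • f.coeff n :=
      fun _ _ => rfl
    simp only [map_add, sm, h1, h2, hA n le_rfl, hQ n le_rfl])
  refine ⟨Q S, A S, P S, by simp [Q, h0], by simp [A, h0], by simp [P, h0], fun n => ?_,
    fun n => ?_, fun n => ?_⟩
  · exact (PowerSeries.coeff_mk _ _).trans (congrArg (·.1) (hS n))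
  · exact (PowerSeries.coeff_mk _ _).trans (congrArg (·.2.1) (hS n))
  · exact (PowerSeries.coeff_mk _ _).trans (congrArg (·.2.2) (hS n))

/-- Induction on the order in `x`. The three majorants are tied together: the ratio `α / β` between
those of `q` and `a` makes `∂ₓ a = ∂ₜ q` balance exactly, and `hN` is what the equation for `q`
requires. The series for `p` is unweighted because `p = -1/(2t)` is not small at `x = 0`. -/
theorem FormalSolution.majorized {h : ℝ → ℝ} {q a p : PowerSeries (ℝ → ℝ)}
    (H : FormalSolution h q a p) {t α β : ℝ} (ht : t < 0) (hα : 0 < α) (hβt : β * -t = 16)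
    {N : ℕ} (hN1 : 1 ≤ N) (hN : β + α ^ 2 ≤ N * α ^ 2) (hs : ContDiffAt ℝ ∞ h t)
    (hh : ∀ j : ℕ, |iteratedDeriv j h t| ≤
      j.factorial * β ^ j * (α / β * (1 / 8) / (N : ℝ) ^ N)) (n : ℕ) :
    Majorized t α β n q ((α / β * (1 / 8)) • wcatSeries N) ∧
    Majorized t α β n a ((1 / 8 : ℝ) • wcatSeries N) ∧
    Majorized t α β n p ((-t)⁻¹ • catSeries) := by
  have ht' : 0 < -t := by linarith
  have hβ : 0 < β := by
    by_contra hneg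
    nlinarith
  have hNp : (0 : ℝ) < N := by exact_mod_cast hN1
  induction n with
  | zero =>
    refine ⟨?_, ?_, ?_⟩
    · intro k hk
      obtain rfl : k = 0 := by omega
      rw [H.q_zero]
      refine ⟨hs, fun j => ?_⟩
      -- The weight is smallest at index `0`, with value `N^(-N)`; hence the smallness demanded of
      -- `h`.
      have hw : (1 : ℝ) / (N : ℝ) ^ N ≤ weight N (0 + j) * (catalan (0 + j) : ℝ) := by
        have h1 : weight N 0 ≤ weight N (0 + j) := weight_mono hN1 (Nat.zero_le _)
        have h2 : (1 : ℝ) ≤ catalan (0 + j) := by exact_mod_cast one_le_catalan _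
        have h3 : weight N 0 = 1 / (N : ℝ) ^ N := by simp [weight]
        rw [← h3]
        nlinarith [weight_nonneg (N := N) 0]
      have := hh j
      simp only [Nat.factorial_zero, Nat.cast_one, mul_one, pow_zero, one_mul,
        PowerSeries.coeff_smul, wcatSeries, PowerSeries.coeff_mk, smul_eq_mul]
      refine this.trans ?_
      calc _ = (j.factorial * β ^ j * (α / β * (1 / 8))) * (1 / (N : ℝ) ^ N) := by ring
        _ ≤ (j.factorial * β ^ j * (α / β * (1 / 8))) * _ :=
          mul_le_mul_of_nonneg_left hw (by positivity)
        _ = _ := by rw [Nat.zero_add]; ring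
    · intro k hk
      obtain rfl : k = 0 := by omega
      rw [H.a_zero]
      refine ⟨contDiffAt_const, fun j => ?_⟩
      have h0 := coeffLE_wcatSeries (N := N) (0 + j)
      rw [map_zero] at h0
      rw [iteratedDeriv_const, PowerSeries.coeff_smul, smul_eq_mul]
      simp only [ite_self, abs_zero, zero_mul]
      positivity
    · intro k hk
      obtain rfl : k = 0 := by omega
      rw [H.p_zero]
      refine ⟨contDiffAt_const.mul (contDiffAt_inv ℝ ht.ne), fun j => ?_⟩
      rw [iteratedDeriv_const_mul_field, iteratedDeriv_eq_iterate]
      rw [iter_deriv_inv]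
      have h2 : (1 : ℝ) ≤ catalan j := by exact_mod_cast one_le_catalan _
      have e : |-(1 / 2) * ((-1) ^ j * (j.factorial : ℝ) * t ^ (-1 - j : ℤ))| =
          1 / 2 * (j.factorial * ((-t)⁻¹ * ((-t)⁻¹) ^ j)) := by
        rw [abs_mul, abs_mul, abs_mul, abs_pow, abs_neg, abs_neg, abs_one, one_pow,
          Nat.abs_cast, abs_zpow, abs_of_neg ht, zpow_sub₀ ht'.ne']
        rw [abs_of_pos (by norm_num : (0:ℝ) < 1 / 2)]
        rw [zpow_neg, zpow_one, zpow_natCast, inv_pow]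
        ring
      have hle : (-t)⁻¹ ≤ β := by
        rw [inv_le_iff_one_le_mul₀ ht']; linarith
      simp only [Nat.factorial_zero, Nat.cast_one, mul_one, pow_zero, one_mul, zero_add,
        PowerSeries.coeff_smul, catSeries, PowerSeries.coeff_mk, smul_eq_mul]
      rw [e]
      have h3 : ((-t)⁻¹) ^ j ≤ β ^ j := pow_le_pow_left₀ (by positivity) hle j
      have h4 : ((-t)⁻¹) ^ j * 1 ≤ β ^ j * catalan j := mul_le_mul h3 h2 (by norm_num)
        (by positivity)
      have h5 : 0 ≤ (j.factorial : ℝ) * (-t)⁻¹ := by positivity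
      have h6 : (0 : ℝ) ≤ ((-t)⁻¹) ^ j := by positivity
      nlinarith [mul_le_mul_of_nonneg_left h4 h5, mul_nonneg h5 h6]
  | succ n ih =>
    obtain ⟨hq, ha, hp⟩ := ih
    have F0 : ∀ m, 0 ≤ (wcatSeries N).coeff m := fun m => by
      simpa using coeffLE_wcatSeries (N := N) m
    have C0 : ∀ m, 0 ≤ catSeries.coeff m := fun m => by simpa using coeffLE_catSeries m
    refine ⟨?_, ?_, ?_⟩
    · have ha2 := ha.add ((Majorized.one (t := t) (α := α) (β := β) (n := n)).smul 2)
      refine hq.succ hα.le hβ.le (ha.add ((hq.mul (hq.mul (ha2.mul hp))).smul (1 / 4)))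
        (H.q_succ n) fun m => ?_
      have e : (1 / 8 : ℝ) • wcatSeries N + |(1 / 4 : ℝ)| • ((α / β * (1 / 8)) • wcatSeries N *
          ((α / β * (1 / 8)) • wcatSeries N * (((1 / 8 : ℝ) • wcatSeries N + |(2 : ℝ)| • 1) *
            (-t)⁻¹ • catSeries))) =
          (1 / 8 : ℝ) • wcatSeries N + ((α / β) ^ 2 * (-t)⁻¹ / 2048) •
            (wcatSeries N * (wcatSeries N * (wcatSeries N * catSeries))) +
          ((α / β) ^ 2 * (-t)⁻¹ / 128) • (wcatSeries N * (wcatSeries N * catSeries)) := by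
        rw [abs_of_pos (by norm_num : (0 : ℝ) < 1 / 4), abs_of_pos (by norm_num : (0 : ℝ) < 2)]
        simp only [smul_mul_assoc, mul_smul_comm, add_mul, mul_add, smul_add, smul_smul, one_mul]
        module
      rw [e]
      have h1 := (wcatSeries_cube_mul_catSeries_le hN1) m
      have h2 := (wcatSeries_sq_mul_catSeries_le hN1) m
      have h3 := mul_coeff_wcatSeries_le hN1 m
      simp only [map_add, PowerSeries.coeff_smul, smul_eq_mul] at h1 h2 ⊢
      have K0 : 0 ≤ (α / β) ^ 2 * (-t)⁻¹ := by positivity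
      set K := (α / β) ^ 2 * (-t)⁻¹ with hK
      have hKe : K = α ^ 2 / β / 16 := by
        rw [hK, ← hβt]; field_simp
      have hc : 1 / 8 + K * (40 / 256) ≤ α * (α / β * (1 / 8)) * N := by
        rw [hKe]
        have : 1 + α ^ 2 / β ≤ N * α ^ 2 / β := by
          rw [show 1 + α ^ 2 / β = (β + α ^ 2) / β by field_simp]
          gcongr
        have e2 : α * (α / β * (1 / 8)) * N = (N * α ^ 2 / β) / 8 := by ring
        rw [e2]
        have : 0 ≤ α ^ 2 / β := by positivity
        linarith
      calc _ ≤ 1 / 8 * (wcatSeries N).coeff m + K / 2048 * (64 * (wcatSeries N).coeff m) +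
            K / 128 * (16 * (wcatSeries N).coeff m) := by gcongr
        _ = (1 / 8 + K * (40 / 256)) * (wcatSeries N).coeff m := by ring
        _ ≤ (α * (α / β * (1 / 8)) * N) * (wcatSeries N).coeff m :=
          mul_le_mul_of_nonneg_right hc (F0 m)
        _ = (α * (α / β * (1 / 8))) * (N * (wcatSeries N).coeff m) := by ring
        _ ≤ (α * (α / β * (1 / 8))) * ((m + 1) * (wcatSeries N).coeff (m + 1)) :=
          mul_le_mul_of_nonneg_left h3 (by positivity)
        _ = _ := by ring
    · intro k hk
      rcases Nat.lt_or_ge k (n + 1) with hk' | hk'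
      · exact ha k (by omega)
      obtain rfl : k = n + 1 := le_antisymm hk hk'
      obtain ⟨hs, hb⟩ := hq n le_rfl
      rw [H.a_succ]
      refine ⟨contDiffAt_const.smul ?_, fun j => ?_⟩
      · exact hs.derivWithin (m := ∞) (by simp)
      have hn : (0 : ℝ) < n + 1 := by positivity
      rw [iteratedDeriv_const_smul_field, ← iteratedDeriv_succ', smul_eq_mul, abs_mul,
        abs_of_pos (inv_pos.2 hn), Nat.factorial_succ]
      push_cast
      -- An `x`-derivative of `a` is a `t`-derivative of `q`, of the same total order; only a factor
      -- `β / α` changes, and it cancels the `α / β` in the majorant of `q`.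
      calc _ = |iteratedDeriv (j + 1) (q.coeff n) t| * n.factorial := by field_simp
        _ ≤ _ := hb (j + 1)
        _ = _ := by
          rw [show n + 1 + j = n + (j + 1) by omega, PowerSeries.coeff_smul,
            PowerSeries.coeff_smul, smul_eq_mul, smul_eq_mul]
          field_simp
          ring
    · refine hp.succ hα.le hβ.le ((hp.mul (hp.mul hq)).smul (-1)) (H.p_succ n) fun m => ?_
      have h1 := catSeries_sq_mul_wcatSeries_le hN1 m
      have h2 := wcatSeries_le hN1 m
      have h3 := coeff_catSeries_le m
      have h4 := C0 m
      rw [abs_neg, abs_one, one_smul, smul_mul_assoc, smul_mul_assoc, mul_smul_comm,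
        mul_smul_comm, mul_smul_comm]
      simp only [PowerSeries.coeff_smul, smul_eq_mul] at h1 ⊢
      have e : (-t)⁻¹ = β / 16 := by rw [← hβt]; field_simp
      calc _ = (-t)⁻¹ * α * (1 / 128) * (catSeries * (catSeries * wcatSeries N)).coeff m := by
            nth_rewrite 2 [e]; field_simp; ring
        _ ≤ (-t)⁻¹ * α * (1 / 128) * (16 * (wcatSeries N).coeff m) := by gcongr
        _ ≤ (-t)⁻¹ * α * (1 / 128) * (16 * ((m + 1) * catSeries.coeff (m + 1))) := by
            gcongr; exact h2.trans h3
        _ = (-t)⁻¹ * α * (1 / 8) * ((m + 1) * catSeries.coeff (m + 1)) := by ring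
        _ ≤ (-t)⁻¹ * α * 1 * ((m + 1) * catSeries.coeff (m + 1)) := by
            have := C0 (m + 1)
            gcongr; norm_num
        _ = _ := by ring

/-! ### Convergence and termwise differentiation -/

/-- The sum of a power series in `x` whose coefficients are functions of `t`. -/
noncomputable def seriesEval (f : PowerSeries (ℝ → ℝ)) (x t : ℝ) : ℝ := ∑' k, f.coeff k t * x ^ k

/-- Differentiation of the coefficients. -/
noncomputable def coeffDeriv (f : PowerSeries (ℝ → ℝ)) : PowerSeries (ℝ → ℝ) :=
  PowerSeries.mk fun k => deriv (f.coeff k)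

/-- The plane region `|x| < R t`, `-1 < t < 0`. -/
def planeRegion (R : ℝ → ℝ) : Set (ℝ × ℝ) := {z | z.2 ∈ Ioo (-1 : ℝ) 0 ∧ |z.1| < R z.2}

theorem isOpen_planeRegion {R : ℝ → ℝ} (hR : ContinuousOn R (Ioo (-1 : ℝ) 0)) :
    IsOpen (planeRegion R) := by
  have hc : ContinuousOn (fun z : ℝ × ℝ => R z.2 - |z.1|) (Prod.snd ⁻¹' Ioo (-1 : ℝ) 0) :=
    (hR.comp continuousOn_snd fun z hz => hz).sub (continuous_abs.comp continuous_fst).continuousOn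
  convert hc.isOpen_inter_preimage (isOpen_Ioo.preimage continuous_snd) isOpen_Ioi (t := Ioi 0)
    using 1
  ext z
  simp [planeRegion]

/-- The coefficients of `f` are smooth, and all their derivatives satisfy local bounds which ensure
the convergence of the differentiated series for `|x| < R t`. -/
def SmoothlyConvergent (R : ℝ → ℝ) (f : PowerSeries (ℝ → ℝ)) : Prop :=
  ∀ t₀ ∈ Ioo (-1 : ℝ) 0, (∀ k, ContDiffAt ℝ ∞ (f.coeff k) t₀) ∧
    ∀ j : ℕ, ∀ ρ, 0 < ρ → ρ < R t₀ → ∃ C, ∀ᶠ t in 𝓝 t₀, ∀ k,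
      |iteratedDeriv j (f.coeff k) t| * ρ ^ k ≤ C

namespace SmoothlyConvergent

variable {R : ℝ → ℝ} {f g : PowerSeries (ℝ → ℝ)}

theorem of_bound (hR : ContinuousOn R (Ioo (-1 : ℝ) 0))
    (hs : ∀ t ∈ Ioo (-1 : ℝ) 0, ∀ k, ContDiffAt ℝ ∞ (f.coeff k) t)
    (B : ℕ → ℝ → ℝ) (hB : ∀ j, ContinuousOn (B j) (Ioo (-1 : ℝ) 0))
    (h : ∀ t ∈ Ioo (-1 : ℝ) 0, ∀ j k, |iteratedDeriv j (f.coeff k) t| * R t ^ k ≤ B j t) :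
    SmoothlyConvergent R f := by
  intro t₀ ht₀
  refine ⟨hs t₀ ht₀, fun j ρ hρ hρR => ⟨B j t₀ + 1, ?_⟩⟩
  have hn := Ioo_mem_nhds ht₀.1 ht₀.2
  filter_upwards [hn, (hR.continuousAt hn).eventually (lt_mem_nhds hρR),
    ((hB j).continuousAt hn).eventually (gt_mem_nhds (lt_add_one (B j t₀)))] with t h1 h2 h3 k
  refine le_trans ?_ ((h t h1 j k).trans h3.le)
  gcongr

theorem coeffDeriv (hf : SmoothlyConvergent R f) : SmoothlyConvergent R (coeffDeriv f) := by
  intro t₀ ht₀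
  refine ⟨fun k => ?_, fun j ρ hρ hρR => ?_⟩
  · rw [_root_.coeffDeriv, PowerSeries.coeff_mk]
    exact ((hf t₀ ht₀).1 k).derivWithin (m := ∞) (by simp)
  · obtain ⟨C, hC⟩ := (hf t₀ ht₀).2 (j + 1) ρ hρ hρR
    refine ⟨C, hC.mono fun t ht k => ?_⟩
    rw [_root_.coeffDeriv, PowerSeries.coeff_mk, ← iteratedDeriv_succ']
    exact ht k

theorem coeff_derivative_eq (f : PowerSeries (ℝ → ℝ)) (k : ℕ) :
    (PowerSeries.derivative (ℝ → ℝ) f).coeff k = ((k : ℝ) + 1) • f.coeff (k + 1) := by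
  rw [PowerSeries.coeff_derivative, mul_comm]
  rfl

/-- The factor `k + 1` is absorbed by passing from a larger radius `ρ'` to `ρ`: the terms `k
(ρ/ρ')ᵏ` are bounded by their finite sum. -/
theorem derivative (hf : SmoothlyConvergent R f) :
    SmoothlyConvergent R (PowerSeries.derivative (ℝ → ℝ) f) := by
  intro t₀ ht₀
  refine ⟨fun k => ?_, fun j ρ hρ hρR => ?_⟩
  · rw [coeff_derivative_eq]
    exact contDiffAt_const.smul ((hf t₀ ht₀).1 (k + 1))
  · obtain ⟨ρ', h1, h2⟩ := exists_between hρR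
    have hρ' : 0 < ρ' := hρ.trans h1
    obtain ⟨C, hC⟩ := (hf t₀ ht₀).2 j ρ' hρ' h2
    have hr : ρ / ρ' < 1 := (div_lt_one hρ').2 h1
    have hsum : Summable fun k : ℕ => (k : ℝ) ^ 1 * (ρ / ρ') ^ k :=
      summable_pow_mul_geometric_of_norm_lt_one 1
        (by rwa [Real.norm_eq_abs, abs_of_pos (by positivity)])
    have hT0 : ∀ k : ℕ, (k : ℝ) ^ 1 * (ρ / ρ') ^ k ≤ ∑' k : ℕ, (k : ℝ) ^ 1 * (ρ / ρ') ^ k :=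
      fun k => hsum.le_tsum k fun i _ => by positivity
    refine ⟨(∑' k : ℕ, (k : ℝ) ^ 1 * (ρ / ρ') ^ k) * C / ρ, hC.mono fun t ht k => ?_⟩
    rw [coeff_derivative_eq, iteratedDeriv_const_smul_field, smul_eq_mul, abs_mul,
      abs_of_nonneg (by positivity)]
    have h3 := ht (k + 1)
    have h4 := hT0 (k + 1)
    push_cast at h4
    rw [le_div_iff₀ hρ]
    calc _ = (((k : ℝ) + 1) ^ 1 * (ρ / ρ') ^ (k + 1)) *
          (|iteratedDeriv j (f.coeff (k + 1)) t| * ρ' ^ (k + 1)) := by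
          rw [div_pow]; field_simp; ring
      _ ≤ _ := mul_le_mul h4 h3 (by positivity) (le_trans (by positivity) h4)

theorem summable (hf : SmoothlyConvergent R f) {x t : ℝ} (hz : (x, t) ∈ planeRegion R) :
    Summable fun k => ‖f.coeff k t * x ^ k‖ := by
  obtain ⟨ρ, h1, h2⟩ := exists_between hz.2
  have hρ : 0 < ρ := (abs_nonneg x).trans_lt h1
  obtain ⟨C, hC⟩ := (hf t hz.1).2 0 ρ hρ h2
  have hC := hC.self_of_nhds
  have hr : |x| / ρ < 1 := (div_lt_one hρ).2 h1
  refine Summable.of_nonneg_of_le (fun _ => norm_nonneg _) (fun k => ?_)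
    ((summable_geometric_of_lt_one (by positivity) hr).mul_left C)
  have h3 := hC k
  rw [iteratedDeriv_zero] at h3
  rw [norm_mul, norm_pow, Real.norm_eq_abs, Real.norm_eq_abs]
  calc _ = |f.coeff k t| * ρ ^ k * (|x| / ρ) ^ k := by rw [div_pow]; field_simp
    _ ≤ _ := by gcongr

theorem eval_mul_of_summable {x t : ℝ} (hf : Summable fun k => ‖f.coeff k t * x ^ k‖)
    (hg : Summable fun k => ‖g.coeff k t * x ^ k‖) :
    (Summable fun k => ‖(f * g).coeff k t * x ^ k‖) ∧
    seriesEval (f * g) x t = seriesEval f x t * seriesEval g x t := by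
  have e : ∀ k, (f * g).coeff k t * x ^ k = ∑ p ∈ Finset.HasAntidiagonal.antidiagonal k,
      f.coeff p.1 t * x ^ p.1 * (g.coeff p.2 t * x ^ p.2) := by
    intro k
    rw [PowerSeries.coeff_mul, Finset.sum_apply, Finset.sum_mul]
    refine Finset.sum_congr rfl fun p hp => ?_
    rw [← Finset.HasAntidiagonal.mem_antidiagonal.1 hp, Pi.mul_apply, pow_add]
    ring
  unfold seriesEval
  constructor
  · simp only [e]
    exact summable_norm_sum_mul_antidiagonal_of_summable_norm
      (f := fun k => f.coeff k t * x ^ k) (g := fun k => g.coeff k t * x ^ k) hf hg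
  · have h := tsum_mul_tsum_eq_tsum_sum_antidiagonal_of_summable_norm
      (f := fun k => f.coeff k t * x ^ k) (g := fun k => g.coeff k t * x ^ k) hf hg
    exact (tsum_congr e).trans h.symm

/-- Near `(x, t)` the differentials of the terms are dominated by a convergent series, by the bounds
of orders `0` and `1` on a slightly larger radius, so termwise differentiation is allowed. -/
theorem hasFDerivAt (hf : SmoothlyConvergent R f) {x t : ℝ} (hz : (x, t) ∈ planeRegion R) :
    HasFDerivAt (fun z : ℝ × ℝ => seriesEval f z.1 z.2)
      (seriesEval (PowerSeries.derivative (ℝ → ℝ) f) x t • ContinuousLinearMap.fst ℝ ℝ ℝ +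
        seriesEval (_root_.coeffDeriv f) x t • ContinuousLinearMap.snd ℝ ℝ ℝ) (x, t) := by
  obtain ⟨ρ, h1, h2⟩ := exists_between hz.2
  obtain ⟨ρ', h3, h4⟩ := exists_between h2
  have hρ : 0 < ρ := (abs_nonneg x).trans_lt h1
  have hρ' : 0 < ρ' := hρ.trans h3
  obtain ⟨C, hC⟩ := (hf t hz.1).2 0 ρ' hρ' h4
  obtain ⟨C', hC'⟩ := (hf t hz.1).2 1 ρ' hρ' h4
  obtain ⟨δ, hδ, hball⟩ := Metric.eventually_nhds_iff_ball.1
    (hC.and (hC'.and (Ioo_mem_nhds hz.1.1 hz.1.2)))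
  have hr : ρ / ρ' < 1 := (div_lt_one hρ').2 h3
  have hr' : ‖ρ / ρ'‖ < 1 := by rwa [Real.norm_eq_abs, abs_of_pos (by positivity)]
  have hC0 : 0 ≤ C := le_trans (by positivity) ((hball t (Metric.mem_ball_self hδ)).1 0)
  have hsum1 : Summable fun k : ℕ => (k : ℝ) ^ 1 * (ρ / ρ') ^ k :=
    summable_pow_mul_geometric_of_norm_lt_one 1 hr'
  have hsum0 : Summable fun k : ℕ => (ρ / ρ') ^ k := summable_geometric_of_norm_lt_one hr'
  have hsum := (hsum1.mul_left (C / ρ)).add (hsum0.mul_left C')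
  let s : Set (ℝ × ℝ) := Metric.ball 0 ρ ×ˢ Metric.ball t δ
  have hxs : (x, t) ∈ s := ⟨by simpa using h1, Metric.mem_ball_self hδ⟩
  have main := hasFDerivAt_tsum_of_isPreconnected (𝕜 := ℝ) (s := s)
    (f := fun k (z : ℝ × ℝ) => f.coeff k z.2 * z.1 ^ k)
    (f' := fun k (z : ℝ × ℝ) =>
      (f.coeff k z.2 * (k * z.1 ^ (k - 1))) • ContinuousLinearMap.fst ℝ ℝ ℝ +
      (deriv (f.coeff k) z.2 * z.1 ^ k) • ContinuousLinearMap.snd ℝ ℝ ℝ)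
    hsum (Metric.isOpen_ball.prod Metric.isOpen_ball)
    ((convex_ball _ _).prod (convex_ball _ _)).isPreconnected ?_ ?_ hxs
    (hf.summable hz).of_norm hxs
  · have e1 := (hf.derivative.summable hz).of_norm.hasSum
    have e2 := (hf.coeffDeriv.summable hz).of_norm.hasSum
    have e1' : HasSum (fun k : ℕ => f.coeff k t * (k * x ^ (k - 1)))
        (seriesEval (PowerSeries.derivative (ℝ → ℝ) f) x t) := by
      -- The term `k = 0`, where `k - 1` is truncated, vanishes because of its factor `k`; dropping
      -- it shifts the index.
      refine (hasSum_nat_add_iff' (f := fun k : ℕ => f.coeff k t * (k * x ^ (k - 1))) 1).1 ?_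
      simp only [Finset.range_one, Finset.sum_singleton, Nat.cast_zero, zero_mul, mul_zero,
        sub_zero, Nat.add_sub_cancel]
      convert! e1 using 2 with k
      rw [coeff_derivative_eq]
      simp
      ring
    have e2' : HasSum (fun k : ℕ => deriv (f.coeff k) t * x ^ k)
        (seriesEval (_root_.coeffDeriv f) x t) := by
      convert! e2 using 2 with k
      simp [_root_.coeffDeriv]
    have e3 := ((e1'.smul_const (ContinuousLinearMap.fst ℝ ℝ ℝ)).add
      (e2'.smul_const (ContinuousLinearMap.snd ℝ ℝ ℝ))).tsum_eq
    rw [← e3]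
    exact main
  · intro k z hz'
    have hzt := (hball z.2 hz'.2).2.2
    have d1 : HasFDerivAt (fun z : ℝ × ℝ => f.coeff k z.2)
        (deriv (f.coeff k) z.2 • ContinuousLinearMap.snd ℝ ℝ ℝ) z := by
      have := ((((hf z.2 hzt).1 k).differentiableAt (by simp)).hasDerivAt).comp_hasFDerivAt z
        (hasFDerivAt_snd (𝕜 := ℝ) (E := ℝ) (F := ℝ) (p := z))
      exact this
    have d2 : HasFDerivAt (fun z : ℝ × ℝ => z.1 ^ k)
        ((k * z.1 ^ (k - 1)) • ContinuousLinearMap.fst ℝ ℝ ℝ) z :=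
      (hasDerivAt_pow k z.1).comp_hasFDerivAt z
        (hasFDerivAt_fst (𝕜 := ℝ) (E := ℝ) (F := ℝ) (p := z))
    convert! d1.mul d2 using 1
    rw [smul_smul, smul_smul, mul_comm (z.1 ^ k)]
  · intro k z hz'
    obtain ⟨b0, b1, _⟩ := hball z.2 hz'.2
    have b0 := b0 k
    have b1 := b1 k
    rw [iteratedDeriv_zero] at b0
    rw [iteratedDeriv_one] at b1
    have hx : |z.1| ≤ ρ := by simpa using (mem_ball_zero_iff.1 hz'.1).le
    refine (norm_add_le _ _).trans (add_le_add ?_ ?_)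
    · rw [norm_smul]
      refine (mul_le_of_le_one_right (norm_nonneg _)
        (ContinuousLinearMap.norm_fst_le ℝ ℝ ℝ)).trans ?_
      rw [norm_mul, norm_mul, norm_pow, Real.norm_eq_abs, Real.norm_eq_abs, Real.norm_eq_abs,
        Nat.abs_cast]
      rcases k with _ | k
      · simp
      · rw [Nat.add_sub_cancel]
        calc _ ≤ |f.coeff (k + 1) z.2| * (((k + 1 : ℕ) : ℝ) * ρ ^ k) := by gcongr
          _ = (|f.coeff (k + 1) z.2| * ρ' ^ (k + 1)) / ρ *
              (((k + 1 : ℕ) : ℝ) ^ 1 * (ρ / ρ') ^ (k + 1)) := by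
            rw [div_pow]; field_simp; ring
          _ ≤ _ := by gcongr
    · rw [norm_smul]
      refine (mul_le_of_le_one_right (norm_nonneg _)
        (ContinuousLinearMap.norm_snd_le ℝ ℝ ℝ)).trans ?_
      rw [norm_mul, norm_pow, Real.norm_eq_abs, Real.norm_eq_abs]
      calc _ ≤ |deriv (f.coeff k) z.2| * ρ ^ k := by gcongr
        _ = |deriv (f.coeff k) z.2| * ρ' ^ k * (ρ / ρ') ^ k := by rw [div_pow]; field_simp
        _ ≤ _ := by gcongr

/-- Both partial derivatives are sums of series of the same class, so smoothness follows by
induction on the order. -/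
theorem contDiffOn (hR : ContinuousOn R (Ioo (-1 : ℝ) 0)) (hf : SmoothlyConvergent R f) :
    ContDiffOn ℝ ∞ (fun z : ℝ × ℝ => seriesEval f z.1 z.2) (planeRegion R) := by
  refine contDiffOn_infty.2 fun n => ?_
  induction n generalizing f with
  | zero =>
    exact contDiffOn_zero.2 fun z hz => (hf.hasFDerivAt hz).continuousAt.continuousWithinAt
  | succ n ih =>
    have := (contDiffOn_succ_iff_hasFDerivWithinAt_of_uniqueDiffOn (𝕜 := ℝ) (n := n)
      (f := fun z : ℝ × ℝ => seriesEval f z.1 z.2) (isOpen_planeRegion hR).uniqueDiffOn).2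
      ⟨by simp, fun z => seriesEval (PowerSeries.derivative (ℝ → ℝ) f) z.1 z.2 •
        ContinuousLinearMap.fst ℝ ℝ ℝ +
        seriesEval (_root_.coeffDeriv f) z.1 z.2 • ContinuousLinearMap.snd ℝ ℝ ℝ,
        ((ih hf.derivative).smul contDiffOn_const).add ((ih hf.coeffDeriv).smul contDiffOn_const),
        fun z hz => (hf.hasFDerivAt hz).hasFDerivWithinAt⟩
    exact_mod_cast this

theorem hasDerivAt_fst (hf : SmoothlyConvergent R f) {x t : ℝ} (hz : (x, t) ∈ planeRegion R) :
    HasDerivAt (fun y => seriesEval f y t)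
      (seriesEval (PowerSeries.derivative (ℝ → ℝ) f) x t) x := by
  have := (hf.hasFDerivAt hz).comp_hasDerivAt x ((hasDerivAt_id x).prodMk (hasDerivAt_const x t))
  convert! this using 1
  simp

theorem hasDerivAt_snd (hf : SmoothlyConvergent R f) {x t : ℝ} (hz : (x, t) ∈ planeRegion R) :
    HasDerivAt (fun s => seriesEval f x s) (seriesEval (_root_.coeffDeriv f) x t) t := by
  have := (hf.hasFDerivAt hz).comp_hasDerivAt t ((hasDerivAt_const t x).prodMk (hasDerivAt_id t))
  convert! this using 1
  simp

end SmoothlyConvergent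

/-! ### Geometry of surfaces of revolution -/

section Revolution

theorem hasDerivAt_vec3 {a b c : ℝ → ℝ} {a' b' c' x : ℝ} (ha : HasDerivAt a a' x)
    (hb : HasDerivAt b b' x) (hc : HasDerivAt c c' x) :
    HasDerivAt (fun y => (!₂[a y, b y, c y] : E3)) !₂[a', b', c'] x := by
  rw [hasDerivAt_iff_hasFDerivAt, ← hasFDerivWithinAt_univ, hasFDerivWithinAt_euclidean]
  intro i
  rw [hasFDerivWithinAt_univ, hasFDerivAt_iff_hasDerivAt]
  fin_cases i
  · simpa using ha
  · simpa using hb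
  · simpa using hc

theorem inner_vec3 (a b c a' b' c' : ℝ) :
    inner ℝ (!₂[a, b, c] : E3) !₂[a', b', c'] = a * a' + b * b' + c * c' := by
  simp [PiLp.inner_apply, Fin.sum_univ_three]
  ring

/-- The surface of revolution about the first coordinate axis with radius `ρ`. -/
noncomputable def revSurface (ρ : ℝ → ℝ) (x θ : ℝ) : E3 :=
  !₂[x, ρ x * Real.cos θ, ρ x * Real.sin θ]

/-- The radial unit vector. -/
noncomputable def radial (θ : ℝ) : E3 := !₂[0, Real.cos θ, Real.sin θ]

theorem normalPart_eq {F : ℝ → ℝ → E3} {x θ : ℝ} {v n : E3}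
    (hn : ∀ i, inner ℝ (pd i F x θ) n = 0) (hv : v - n ∈ tangentPlane F x θ) :
    normalPart F x θ v = n := by
  refine Submodule.eq_starProjection_of_mem_orthogonal ?_
    (Submodule.le_orthogonal_orthogonal _ hv)
  rw [Submodule.mem_orthogonal]
  intro w hw
  induction hw using Submodule.span_induction with
  | mem w hw => obtain ⟨i, rfl⟩ := hw; exact hn i
  | zero => simp
  | add a b _ _ ha hb => rw [inner_add_left, ha, hb, add_zero]
  | smul r a _ ha => rw [inner_smul_left, ha, mul_zero]

/-- The profile `ρ` of a surface of revolution is twice differentiable at `x`, with derivatives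
`ρ₁` near `x` and `ρ₂` at `x`, and positive at `x`. -/
structure ProfileAt (ρ ρ₁ : ℝ → ℝ) (ρ₂ x : ℝ) : Prop where
  pos : 0 < ρ x
  first : ∀ᶠ y in 𝓝 x, HasDerivAt ρ (ρ₁ y) y
  second : HasDerivAt ρ₁ ρ₂ x

/-- The normal component of the radial vector. -/
noncomputable def radialNormal (ρ₁ : ℝ → ℝ) (x θ : ℝ) : E3 :=
  !₂[-(ρ₁ x) / (1 + ρ₁ x ^ 2), Real.cos θ / (1 + ρ₁ x ^ 2), Real.sin θ / (1 + ρ₁ x ^ 2)]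

theorem pd_zero_revSurface {ρ : ℝ → ℝ} {r x : ℝ} (h : HasDerivAt ρ r x) (θ : ℝ) :
    pd 0 (revSurface ρ) x θ = !₂[1, r * Real.cos θ, r * Real.sin θ] := by
  rw [pd, if_pos rfl]
  exact (hasDerivAt_vec3 (hasDerivAt_id x) (h.mul_const _) (h.mul_const _)).deriv

theorem pd_one_revSurface (ρ : ℝ → ℝ) (x θ : ℝ) :
    pd 1 (revSurface ρ) x θ = !₂[0, ρ x * -Real.sin θ, ρ x * Real.cos θ] := by
  rw [pd, if_neg (by decide)]
  exact (hasDerivAt_vec3 (hasDerivAt_const θ x) ((Real.hasDerivAt_cos θ).const_mul _)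
    ((Real.hasDerivAt_sin θ).const_mul _)).deriv

namespace ProfileAt

variable {ρ ρ₁ : ℝ → ℝ} {ρ₂ x : ℝ}

theorem pd_zero (h : ProfileAt ρ ρ₁ ρ₂ x) (θ : ℝ) : pd 0 (revSurface ρ) x θ = !₂[1, ρ₁ x * Real.cos θ, ρ₁ x * Real.sin θ] :=
  pd_zero_revSurface h.first.self_of_nhds θ

theorem pd_zero_zero (h : ProfileAt ρ ρ₁ ρ₂ x) (θ : ℝ) : pd 0 (pd 0 (revSurface ρ)) x θ = ρ₂ • radial θ := by
  rw [pd, if_pos rfl]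
  have e : (fun y => pd 0 (revSurface ρ) y θ) =ᶠ[𝓝 x]
      fun y => !₂[1, ρ₁ y * Real.cos θ, ρ₁ y * Real.sin θ] :=
    h.first.mono fun y hy => pd_zero_revSurface hy θ
  rw [e.deriv_eq, (hasDerivAt_vec3 (hasDerivAt_const x 1) (h.second.mul_const _)
    (h.second.mul_const _)).deriv]
  ext i
  fin_cases i <;> simp [radial]

/-- The mixed derivative is tangential, so the second fundamental form is diagonal in these
coordinates. -/
theorem pd_zero_one (h : ProfileAt ρ ρ₁ ρ₂ x) (θ : ℝ) : pd 0 (pd 1 (revSurface ρ)) x θ =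
    (ρ₁ x / ρ x) • pd 1 (revSurface ρ) x θ := by
  have hp := h.pos
  have h1 := h.first.self_of_nhds
  rw [pd, if_pos rfl]
  have e : (fun y => pd 1 (revSurface ρ) y θ) =
      fun y => !₂[0, ρ y * -Real.sin θ, ρ y * Real.cos θ] :=
    funext fun y => pd_one_revSurface ρ y θ
  rw [e, (hasDerivAt_vec3 (hasDerivAt_const x 0) (h1.mul_const _) (h1.mul_const _)).deriv,
    pd_one_revSurface]
  ext i
  fin_cases i <;> simp <;> field_simp

theorem pd_one_zero (h : ProfileAt ρ ρ₁ ρ₂ x) (θ : ℝ) : pd 1 (pd 0 (revSurface ρ)) x θ =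
    (ρ₁ x / ρ x) • pd 1 (revSurface ρ) x θ := by
  have hp := h.pos
  rw [pd, if_neg (by decide)]
  have e : (fun η => pd 0 (revSurface ρ) x η) =
      fun η => !₂[1, ρ₁ x * Real.cos η, ρ₁ x * Real.sin η] :=
    funext fun η => h.pd_zero η
  rw [e, (hasDerivAt_vec3 (hasDerivAt_const θ 1) ((Real.hasDerivAt_cos θ).const_mul _)
    ((Real.hasDerivAt_sin θ).const_mul _)).deriv, pd_one_revSurface]
  ext i
  fin_cases i <;> simp <;> field_simp

theorem pd_one_one (ρ : ℝ → ℝ) (x θ : ℝ) : pd 1 (pd 1 (revSurface ρ)) x θ = (-ρ x) • radial θ := by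
  rw [pd, if_neg (by decide)]
  have e : (fun η => pd 1 (revSurface ρ) x η) =
      fun η => !₂[0, ρ x * -Real.sin η, ρ x * Real.cos η] :=
    funext fun η => pd_one_revSurface ρ x η
  rw [e, (hasDerivAt_vec3 (hasDerivAt_const θ 0) ((Real.hasDerivAt_sin θ).fun_neg.const_mul _)
    ((Real.hasDerivAt_cos θ).const_mul _)).deriv]
  ext i
  fin_cases i <;> simp [radial]

theorem normalPart_smul_radial (h : ProfileAt ρ ρ₁ ρ₂ x) (θ : ℝ) (r : ℝ) :
    normalPart (revSurface ρ) x θ (r • radial θ) = r • radialNormal ρ₁ x θ := by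
  have hpos : 0 < 1 + ρ₁ x ^ 2 := by positivity
  refine normalPart_eq (fun i => ?_) ?_
  · rw [inner_smul_right]
    have hsc := Real.sin_sq_add_cos_sq θ
    fin_cases i
    · simp only [Fin.zero_eta]
      rw [h.pd_zero, radialNormal, inner_vec3]
      field_simp
      linear_combination (r * ρ₁ x) * hsc
    · simp only [Fin.mk_one]
      rw [pd_one_revSurface, radialNormal, inner_vec3]
      ring
  · have e : r • radial θ - r • radialNormal ρ₁ x θ =
        (r * ρ₁ x / (1 + ρ₁ x ^ 2)) • pd 0 (revSurface ρ) x θ := by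
      rw [h.pd_zero]
      ext i
      fin_cases i <;> simp [radial, radialNormal] <;> field_simp <;> ring
    rw [e]
    exact Submodule.smul_mem _ _ (Submodule.subset_span ⟨0, rfl⟩)

theorem normalPart_smul_pd_one (θ : ℝ) (r : ℝ) :
    normalPart (revSurface ρ) x θ (r • pd 1 (revSurface ρ) x θ) = 0 :=
  normalPart_eq (fun i => inner_zero_right _)
    (by rw [sub_zero]; exact Submodule.smul_mem _ _ (Submodule.subset_span ⟨1, rfl⟩))

theorem firstForm_inv (h : ProfileAt ρ ρ₁ ρ₂ x) (θ : ℝ) : (firstForm (revSurface ρ) x θ)⁻¹ =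
    !![(1 + ρ₁ x ^ 2)⁻¹, 0; 0, (ρ x ^ 2)⁻¹] := by
  have hp := h.pos
  have hpos : 0 < 1 + ρ₁ x ^ 2 := by positivity
  have hsc := Real.sin_sq_add_cos_sq θ
  have e : firstForm (revSurface ρ) x θ = !![1 + ρ₁ x ^ 2, 0; 0, ρ x ^ 2] := by
    ext i j
    fin_cases i <;> fin_cases j <;>
      simp only [firstForm, Matrix.of_apply, Fin.zero_eta, Fin.mk_one, h.pd_zero,
        pd_one_revSurface, inner_vec3] <;> simp
    · linear_combination ρ₁ x ^ 2 * hsc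
    · ring
    · ring
    · linear_combination ρ x ^ 2 * hsc
  rw [e]
  refine Matrix.inv_eq_right_inv ?_
  ext i j
  fin_cases i <;> fin_cases j <;> simp [Matrix.mul_apply, Fin.sum_univ_two, hpos.ne', hp.ne']

theorem secondForm_zero_zero (h : ProfileAt ρ ρ₁ ρ₂ x) (θ : ℝ) :
    secondForm (revSurface ρ) x θ 0 0 = ρ₂ • radialNormal ρ₁ x θ := by
  rw [secondForm, h.pd_zero_zero, h.normalPart_smul_radial]

theorem secondForm_zero_one (h : ProfileAt ρ ρ₁ ρ₂ x) (θ : ℝ) : secondForm (revSurface ρ) x θ 0 1 = 0 := by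
  rw [secondForm, h.pd_zero_one, normalPart_smul_pd_one]

theorem secondForm_one_zero (h : ProfileAt ρ ρ₁ ρ₂ x) (θ : ℝ) : secondForm (revSurface ρ) x θ 1 0 = 0 := by
  rw [secondForm, h.pd_one_zero, normalPart_smul_pd_one]

theorem secondForm_one_one (h : ProfileAt ρ ρ₁ ρ₂ x) (θ : ℝ) :
    secondForm (revSurface ρ) x θ 1 1 = (-ρ x) • radialNormal ρ₁ x θ := by
  rw [secondForm, pd_one_one, h.normalPart_smul_radial]

theorem meanCurvatureVector_eq (h : ProfileAt ρ ρ₁ ρ₂ x) (θ : ℝ) : meanCurvatureVector (revSurface ρ) x θ =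
    (ρ₂ / (1 + ρ₁ x ^ 2) - (ρ x)⁻¹) • radialNormal ρ₁ x θ := by
  have hp := h.pos
  simp only [meanCurvatureVector, Fin.sum_univ_two, h.firstForm_inv, h.secondForm_zero_zero,
    h.secondForm_zero_one, h.secondForm_one_zero, h.secondForm_one_one]
  simp only [Matrix.of_apply, Matrix.cons_val', Matrix.cons_val_zero, Matrix.cons_val_one,
    Matrix.cons_val_fin_one, smul_zero, add_zero, zero_add, smul_smul, ← add_smul]
  congr 1
  field_simp
  ring

theorem normSqSecondForm_eq (h : ProfileAt ρ ρ₁ ρ₂ x) (θ : ℝ) : normSqSecondForm (revSurface ρ) x θ =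
    (ρ₂ ^ 2 / (1 + ρ₁ x ^ 2) ^ 2 + 1 / ρ x ^ 2) / (1 + ρ₁ x ^ 2) := by
  have hp := h.pos
  have hpos : 0 < 1 + ρ₁ x ^ 2 := by positivity
  have hsc := Real.sin_sq_add_cos_sq θ
  have hn : inner ℝ (radialNormal ρ₁ x θ) (radialNormal ρ₁ x θ) = 1 / (1 + ρ₁ x ^ 2) := by
    rw [radialNormal, inner_vec3]
    field_simp
    linear_combination hsc
  simp only [normSqSecondForm, Fin.sum_univ_two, h.firstForm_inv, h.secondForm_zero_zero,
    h.secondForm_zero_one, h.secondForm_one_zero, h.secondForm_one_one]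
  simp only [inner_smul_left, inner_smul_right, hn, inner_zero_left, inner_zero_right,
    Matrix.of_apply, Matrix.cons_val', Matrix.cons_val_zero, Matrix.cons_val_one,
    Matrix.cons_val_fin_one, RCLike.conj_to_real]
  field_simp
  ring

/-- Only the curvature of the parallel circles is kept. -/
theorem le_normSqSecondForm (h : ProfileAt ρ ρ₁ ρ₂ x) (θ : ℝ) :
    1 / (ρ x ^ 2 * (1 + ρ₁ x ^ 2)) ≤ normSqSecondForm (revSurface ρ) x θ := by
  rw [h.normSqSecondForm_eq, ← div_div]
  gcongr
  have : 0 ≤ ρ₂ ^ 2 / (1 + ρ₁ x ^ 2) ^ 2 := by positivity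
  linarith

theorem linearIndependent (h : ProfileAt ρ ρ₁ ρ₂ x) (θ : ℝ) : LinearIndependent ℝ fun i => pd i (revSurface ρ) x θ := by
  have hp := h.pos
  have hsc := Real.sin_sq_add_cos_sq θ
  refine linearIndependent_of_ne_zero_of_inner_eq_zero (𝕜 := ℝ) (fun i => ?_) fun i j hij => ?_
  · intro h0
    have h1 : inner ℝ (pd i (revSurface ρ) x θ) (pd i (revSurface ρ) x θ) = 0 := by
      rw [h0, inner_zero_left]
    fin_cases i
    · simp only [Fin.zero_eta, h.pd_zero, inner_vec3] at h1
      nlinarith [sq_nonneg (ρ₁ x * Real.cos θ), sq_nonneg (ρ₁ x * Real.sin θ)]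
    · simp only [Fin.mk_one, pd_one_revSurface, inner_vec3] at h1
      have : ρ x ^ 2 = 0 := by linear_combination h1 - ρ x ^ 2 * hsc
      simp [hp.ne'] at this
  · fin_cases i <;> fin_cases j <;> simp only [Fin.zero_eta, Fin.mk_one, h.pd_zero,
      pd_one_revSurface, inner_vec3] <;> first | (exact absurd rfl hij) | ring

end ProfileAt

end Revolution

/-! ### Flat analytic Cauchy data -/

section Data

/-- The parameter space: bounded real sequences. -/
abbrev BddSeq : Type := lp (fun _ : ℕ => ℝ) ⊤

theorem not_finiteDimensional_bddSeq : ¬ FiniteDimensional ℝ BddSeq := by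
  intro hfin
  have hli : LinearIndependent ℝ fun i : ℕ => (lp.single ⊤ i (1 : ℝ) : BddSeq) := by
    rw [linearIndependent_iff']
    intro s g hg i hi
    have h := congrArg (fun c : BddSeq => c i) hg
    simp only [lp.coeFn_sum, lp.coeFn_smul, Finset.sum_apply, Pi.smul_apply] at h
    rw [Finset.sum_eq_single i] at h
    · simpa using h
    · intro j _ hj
      simp [Pi.single_eq_of_ne hj.symm]
    · exact fun hn => absurd hi hn
  have := hli.finite
  exact _root_.not_finite ℕ

theorem summable_half : Summable fun j : ℕ => (1 / 2 : ℝ) ^ j :=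
  summable_geometric_of_lt_one (by norm_num) (by norm_num)

theorem norm_coeff_mul_pow_le (c : BddSeq) {z : ℂ} (hz : ‖z‖ ≤ 2) (j : ℕ) :
    ‖(c j : ℂ) * (z / 4) ^ j‖ ≤ ‖c‖ * (1 / 2) ^ j := by
  rw [norm_mul, norm_pow, norm_div, Complex.norm_real]
  have h1 : ‖z‖ / ‖(4 : ℂ)‖ ≤ 1 / 2 := by
    rw [Complex.norm_ofNat]; linarith
  have h2 := lp.norm_apply_le_norm ENNReal.top_ne_zero c j
  gcongr

/-- The power series `∑ cⱼ (z / 4) ^ j`. -/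
noncomputable def seqSeries (c : BddSeq) (z : ℂ) : ℂ := ∑' j, (c j : ℂ) * (z / 4) ^ j

theorem summable_seqSeries (c : BddSeq) {z : ℂ} (hz : ‖z‖ ≤ 2) :
    Summable fun j => (c j : ℂ) * (z / 4) ^ j :=
  Summable.of_norm_bounded (summable_half.mul_left ‖c‖) (norm_coeff_mul_pow_le c hz)

theorem norm_seqSeries_le (c : BddSeq) {z : ℂ} (hz : ‖z‖ ≤ 2) : ‖seqSeries c z‖ ≤ 2 * ‖c‖ := by
  have h := tsum_of_norm_bounded (summable_half.mul_left ‖c‖).hasSum (norm_coeff_mul_pow_le c hz)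
  rwa [tsum_mul_left, tsum_geometric_two, mul_comm] at h

theorem seqSeries_sub (c c' : BddSeq) {z : ℂ} (hz : ‖z‖ ≤ 2) :
    seqSeries (c - c') z = seqSeries c z - seqSeries c' z := by
  unfold seqSeries
  rw [← (summable_seqSeries c hz).tsum_sub (summable_seqSeries c' hz)]
  refine tsum_congr fun j => ?_
  rw [lp.coeFn_sub, Pi.sub_apply]
  push_cast
  ring

theorem differentiableOn_seqSeries (c : BddSeq) :
    DifferentiableOn ℂ (seqSeries c) (Metric.ball 0 2) :=
  Complex.differentiableOn_tsum_of_summable_norm (summable_half.mul_left ‖c‖)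
    (fun j => by fun_prop) Metric.isOpen_ball
    fun j z hz => norm_coeff_mul_pow_le c (by simpa using (mem_ball_zero_iff.1 hz).le) j

theorem seqSeries_ofReal (c : BddSeq) (t : ℝ) :
    seqSeries c t = ((∑' j, c j * (t / 4) ^ j : ℝ) : ℂ) := by
  rw [seqSeries, Complex.ofReal_tsum]
  refine tsum_congr fun j => ?_
  push_cast
  rfl

/-- The identity theorem for analytic functions of a real variable, followed by uniqueness of power
series coefficients. -/
theorem eq_of_frequently_seqSeries_eq {c c' : BddSeq}
    (h : ∃ᶠ t : ℝ in 𝓝[≠] 0, seqSeries c t = seqSeries c' t) : c = c' := by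
  let p : BddSeq → FormalMultilinearSeries ℝ ℝ ℝ :=
    fun c => FormalMultilinearSeries.ofScalars ℝ fun j => c j / 4 ^ j
  have hp : ∀ c, HasFPowerSeriesAt (fun t : ℝ => ∑' j, c j * (t / 4) ^ j) (p c) 0 := by
    intro c
    have hr : 0 < (p c).radius := by
      refine lt_of_lt_of_le (b := ((1 : NNReal) : ENNReal)) (by simp)
        ((p c).le_radius_of_bound ‖c‖ fun n => ?_)
      have h2 := lp.norm_apply_le_norm ENNReal.top_ne_zero c n
      have h3 : (1 : ℝ) ≤ 4 ^ n := one_le_pow₀ (by norm_num)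
      simp only [p, NNReal.coe_one, one_pow, mul_one]
      rw [FormalMultilinearSeries.ofScalars_norm, norm_div, norm_pow]
      refine (div_le_self (norm_nonneg _) ?_).trans h2
      simpa using h3
    have := (p c).hasFPowerSeriesOnBall hr
    refine ⟨_, this.congr fun t _ => ?_⟩
    rw [FormalMultilinearSeries.sum]
    refine tsum_congr fun j => ?_
    simp only [p, FormalMultilinearSeries.ofScalars_apply_eq, smul_eq_mul]
    rw [div_pow]
    ring
  have h' : ∃ᶠ t : ℝ in 𝓝[≠] 0, ∑' j, c j * (t / 4) ^ j = ∑' j, c' j * (t / 4) ^ j :=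
    h.mono fun t ht => by
      rw [seqSeries_ofReal, seqSeries_ofReal] at ht
      exact_mod_cast ht
  have he := ((hp c).analyticAt.frequently_eq_iff_eventually_eq (hp c').analyticAt).1 h'
  have hpp := (hp c).eq_formalMultilinearSeries_of_eventually (hp c') he
  ext j
  have := congrArg (fun q : FormalMultilinearSeries ℝ ℝ ℝ => q.coeff j) hpp
  simp only [p, FormalMultilinearSeries.coeff_ofScalars] at this
  field_simp at this
  exact this

/-- The constant in the exponential factor of the Cauchy data. -/
noncomputable def flatConst : ℝ := 8 * 1026 ^ 2

/-- The complex Cauchy data `exp (-M / z ^ 4) (A + ∑ cⱼ (z / 4) ^ j)`. -/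
noncomputable def complexData (A : ℝ) (c : BddSeq) (z : ℂ) : ℂ :=
  Complex.exp (-(flatConst : ℂ) * (z ^ 4)⁻¹) * (A + seqSeries c z)

/-- The Cauchy data. -/
noncomputable def realData (A : ℝ) (c : BddSeq) (t : ℝ) : ℝ := (complexData A c t).re

/-- The domain of the complex Cauchy data. -/
def dataDomain : Set ℂ := Metric.ball 0 2 ∩ {0}ᶜ

theorem isOpen_dataDomain : IsOpen dataDomain := Metric.isOpen_ball.inter isOpen_compl_singleton

theorem differentiableOn_complexData (A : ℝ) (c : BddSeq) :
    DifferentiableOn ℂ (complexData A c) dataDomain := by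
  have h1 : DifferentiableOn ℂ (fun z : ℂ => Complex.exp (-(flatConst : ℂ) * (z ^ 4)⁻¹))
      dataDomain := by
    refine DifferentiableOn.cexp (DifferentiableOn.const_mul (DifferentiableOn.inv
      (differentiableOn_pow 4) fun z hz => ?_) _)
    exact pow_ne_zero 4 hz.2
  exact h1.mul (((differentiableOn_seqSeries c).mono inter_subset_left).const_add _)

theorem ofReal_mem_dataDomain {t : ℝ} (ht : t ∈ Ioo (-1 : ℝ) 0) : (t : ℂ) ∈ dataDomain := by
  refine ⟨?_, ?_⟩
  · rw [mem_ball_zero_iff, Complex.norm_real, Real.norm_eq_abs, abs_of_neg ht.2]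
    linarith [ht.1]
  · simpa using ht.2.ne

theorem closedBall_subset_dataDomain {t : ℝ} (ht : t ∈ Ioo (-1 : ℝ) 0) :
    Metric.closedBall (t : ℂ) (-t / 16) ⊆ dataDomain := by
  intro z hz
  rw [mem_closedBall_iff_norm] at hz
  have h0 : ‖(t : ℂ)‖ = -t := by rw [Complex.norm_real, Real.norm_eq_abs, abs_of_neg ht.2]
  have h1 := norm_sub_norm_le z (t : ℂ)
  have h2 := norm_sub_norm_le (t : ℂ) z
  rw [norm_sub_rev] at h2
  refine ⟨?_, ?_⟩
  · rw [mem_ball_zero_iff]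
    linarith [ht.1]
  · rintro rfl
    rw [norm_zero] at h2
    linarith [ht.2]

/-- Carries Cauchy's estimates for the complex data over to the real data. -/
theorem iteratedDeriv_re_ofReal {U : Set ℂ} (hU : IsOpen U) {f : ℂ → ℂ}
    (hf : DifferentiableOn ℂ f U) (j : ℕ) {t : ℝ} (ht : (t : ℂ) ∈ U) :
    iteratedDeriv j (fun x : ℝ => (f x).re) t = (iteratedDeriv j f t).re := by
  induction j generalizing f with
  | zero => simp
  | succ j ih =>
    rw [iteratedDeriv_succ', iteratedDeriv_succ', ← ih (hf.deriv hU)]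
    refine Filter.EventuallyEq.iteratedDeriv_eq j ?_
    have : ∀ᶠ x : ℝ in 𝓝 t, (x : ℂ) ∈ U :=
      Complex.continuous_ofReal.continuousAt.eventually (hU.mem_nhds ht)
    filter_upwards [this] with x hx
    exact ((hf.differentiableAt (hU.mem_nhds hx)).hasDerivAt.real_of_complex).deriv

theorem contDiffAt_realData (A : ℝ) (c : BddSeq) {t : ℝ} (ht : t ∈ Ioo (-1 : ℝ) 0) :
    ContDiffAt ℝ ∞ (realData A c) t :=
  ((differentiableOn_complexData A c).analyticAt
    (isOpen_dataDomain.mem_nhds (ofReal_mem_dataDomain ht))).contDiffAt.real_of_complex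

/-- For `e = (1 + ζ)⁴`, `|e - 1| ≤ 7/25`; then `Re e / |e|² ≥ (18/25) / (32/25)²`, which exceeds
`1/4`. -/
theorem quarter_le_re_inv {ζ : ℂ} (hζ : ‖ζ‖ ≤ 1 / 16) : 1 / 4 ≤ (((1 + ζ) ^ 4)⁻¹).re := by
  set e : ℂ := (1 + ζ) ^ 4 with he
  have h1 : ‖e - 1‖ ≤ 7 / 25 := by
    have : e - 1 = ζ * (4 + 6 * ζ + 4 * ζ ^ 2 + ζ ^ 3) := by rw [he]; ring
    rw [this, norm_mul]
    have h2 : ‖4 + 6 * ζ + 4 * ζ ^ 2 + ζ ^ 3‖ ≤ 4 + 6 * ‖ζ‖ + 4 * ‖ζ‖ ^ 2 + ‖ζ‖ ^ 3 := by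
      refine (norm_add_le _ _).trans (add_le_add ((norm_add_le _ _).trans (add_le_add
        ((norm_add_le _ _).trans (add_le_add ?_ ?_)) ?_)) ?_) <;> simp
    have h3 : 4 + 6 * ‖ζ‖ + 4 * ‖ζ‖ ^ 2 + ‖ζ‖ ^ 3 ≤ 4 + 6 * (1 / 16) + 4 * (1 / 16) ^ 2 +
        (1 / 16) ^ 3 := by gcongr
    calc _ ≤ 1 / 16 * (4 + 6 * (1 / 16) + 4 * (1 / 16) ^ 2 + (1 / 16) ^ 3) :=
          mul_le_mul hζ (h2.trans h3) (norm_nonneg _) (by norm_num)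
      _ ≤ _ := by norm_num
  have hre : 1 - 7 / 25 ≤ e.re := by
    have := (abs_le.1 ((Complex.abs_re_le_norm (e - 1)).trans h1)).1
    simp at this
    linarith
  have hn : ‖e‖ ≤ 1 + 7 / 25 := by
    have := norm_sub_norm_le e 1
    simp at this
    linarith
  have hsq : Complex.normSq e ≤ (1 + 7 / 25) ^ 2 := by
    rw [Complex.normSq_eq_norm_sq]
    gcongr
  have hpos : 0 < Complex.normSq e := by
    rw [Complex.normSq_pos]
    rintro h0
    rw [h0] at hre
    norm_num at hre
  rw [Complex.inv_re, le_div_iff₀ hpos]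
  linarith

/-- On the disc of radius `-t/16` about `t`, `Re z⁻⁴` keeps at least a quarter of its value at the
centre. The constant `8 · 1026²` thus leaves `2 · 1026²`: one half will absorb `N^N`, the other
powers of `-t`. -/
theorem norm_exp_flat_le {t : ℝ} (ht : t < 0) {z : ℂ} (hz : ‖z - t‖ ≤ -t / 16) :
    ‖Complex.exp (-(flatConst : ℂ) * (z ^ 4)⁻¹)‖ ≤ Real.exp (-(2 * 1026 ^ 2 / t ^ 4)) := by
  rw [Complex.norm_exp]
  refine Real.exp_le_exp.2 ?_
  have ht0 : (t : ℂ) ≠ 0 := by exact_mod_cast ht.ne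
  have hζ : ‖(z - t) / t‖ ≤ 1 / 16 := by
    rw [norm_div, Complex.norm_real, Real.norm_eq_abs, abs_of_neg ht, div_le_iff₀ (by linarith)]
    linarith
  have h := quarter_le_re_inv hζ
  have e : -(flatConst : ℂ) * (z ^ 4)⁻¹ =
      ((-flatConst / t ^ 4 : ℝ) : ℂ) * ((1 + (z - t) / t) ^ 4)⁻¹ := by
    have : z = t * (1 + (z - t) / t) := by field_simp; ring
    nth_rewrite 1 [this]
    rw [mul_pow, mul_inv]
    push_cast
    ring
  rw [e, Complex.re_ofReal_mul]
  have hne : t ≠ 0 := ht.ne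
  have h4 : 0 < t ^ 4 := by positivity
  have : -flatConst / t ^ 4 ≤ 0 := by
    unfold flatConst
    exact div_nonpos_of_nonpos_of_nonneg (by norm_num) h4.le
  calc _ ≤ -flatConst / t ^ 4 * (1 / 4) := mul_le_mul_of_nonpos_left h this
    _ = _ := by unfold flatConst; ring

/-- Cauchy's estimate on the circle of radius `-t/16` about `t`; this radius is the origin of `β =
16/(-t)`. -/
theorem abs_iteratedDeriv_realData_le {A : ℝ} (hA : 0 ≤ A) (c : BddSeq) {t : ℝ}
    (ht : t ∈ Ioo (-1 : ℝ) 0) (j : ℕ) : |iteratedDeriv j (realData A c) t| ≤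
      j.factorial * (16 / -t) ^ j * (Real.exp (-(2 * 1026 ^ 2 / t ^ 4)) * (A + 2 * ‖c‖)) := by
  have hr : 0 < -t / 16 := by linarith [ht.2]
  have hsub := closedBall_subset_dataDomain ht
  have h := Complex.norm_iteratedDeriv_le_of_forall_mem_sphere_norm_le (f := complexData A c)
    (c := (t : ℂ)) (C := Real.exp (-(2 * 1026 ^ 2 / t ^ 4)) * (A + 2 * ‖c‖)) j hr
    (((differentiableOn_complexData A c).mono hsub).diffContOnCl_ball subset_rfl) (by
      intro z hz
      have hz' := hsub (Metric.sphere_subset_closedBall hz)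
      have hz2 : ‖z‖ ≤ 2 := (mem_ball_zero_iff.1 hz'.1).le
      rw [complexData, norm_mul]
      refine mul_le_mul (norm_exp_flat_le ht.2 (mem_sphere_iff_norm.1 hz).le) ?_ (norm_nonneg _)
        (Real.exp_pos _).le
      refine (norm_add_le _ _).trans (add_le_add ?_ (norm_seqSeries_le c hz2))
      rw [Complex.norm_real, Real.norm_eq_abs, abs_of_nonneg hA])
  have e := iteratedDeriv_re_ofReal isOpen_dataDomain (differentiableOn_complexData A c) j
    (ofReal_mem_dataDomain ht)
  change iteratedDeriv j (realData A c) t = _ at e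
  rw [e]
  refine (Complex.abs_re_le_norm _).trans (h.trans (le_of_eq ?_))
  rw [div_pow, div_pow]
  field_simp

theorem realData_eq (A : ℝ) (c : BddSeq) (t : ℝ) :
    realData A c t = Real.exp (-flatConst * (t ^ 4)⁻¹) * (A + (seqSeries c t).re) := by
  have : Complex.exp (-(flatConst : ℂ) * ((t : ℂ) ^ 4)⁻¹) =
      ((Real.exp (-flatConst * (t ^ 4)⁻¹) : ℝ) : ℂ) := by push_cast; rfl
  rw [realData, complexData, this, Complex.re_ofReal_mul]
  simp

/-- The amplitude `2` beats the series, which is at most `2‖c‖ < 2`. -/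
theorem realData_pos {c : BddSeq} (hc : ‖c‖ < 1) {t : ℝ} (ht : t ∈ Ioo (-1 : ℝ) 0) :
    0 < realData 2 c t := by
  rw [realData_eq]
  have h1 := norm_seqSeries_le c (z := (t : ℂ))
    (mem_ball_zero_iff.1 (ofReal_mem_dataDomain ht).1).le
  have h2 := (abs_le.1 ((Complex.abs_re_le_norm _).trans h1)).1
  exact mul_pos (Real.exp_pos _) (by linarith)

theorem eq_of_realData_eq {c c' : BddSeq} {ε : ℝ} (hε : 0 < ε)
    (h : ∀ t ∈ Ioo (-1 : ℝ) 0, -ε < t → realData 2 c t = realData 2 c' t) : c = c' := by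
  refine eq_of_frequently_seqSeries_eq ?_
  have h1 : ∀ᶠ t : ℝ in 𝓝[<] 0, seqSeries c t = seqSeries c' t := by
    have hm : max (-1) (-ε) < (0 : ℝ) := max_lt (by norm_num) (by linarith)
    filter_upwards [Ioo_mem_nhdsLT hm] with t ht
    have := h t ⟨(le_max_left _ _).trans_lt ht.1, ht.2⟩ ((le_max_right _ _).trans_lt ht.1)
    rw [realData_eq, realData_eq] at this
    have h2 := mul_left_cancel₀ (Real.exp_pos _).ne' this
    rw [seqSeries_ofReal, seqSeries_ofReal] at h2 ⊢
    simp only [Complex.ofReal_re] at h2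
    rw [add_left_cancel h2]
  exact h1.frequently.filter_mono (nhdsWithin_mono _ fun t ht => ne_of_lt ht)

theorem contDiffAt_iteratedDeriv {f : ℝ → ℝ} {t : ℝ} (hf : ContDiffAt ℝ ∞ f t) (j : ℕ) :
    ContDiffAt ℝ ∞ (iteratedDeriv j f) t := by
  induction j with
  | zero => simpa using hf
  | succ j ih =>
    rw [iteratedDeriv_succ]
    exact ih.derivWithin (m := ∞) (by simp)

/-- The data are affine in `c`: the difference from the data of `c₀` is the data of `c - c₀` with
amplitude `0`, whose derivatives are bounded by a multiple of `‖c - c₀‖`, locally uniformly in `t`.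
-/
theorem continuousOn_iteratedDeriv_realData (j : ℕ) :
    ContinuousOn (fun z : BddSeq × ℝ => iteratedDeriv j (realData 2 z.1) z.2)
      (univ ×ˢ Ioo (-1 : ℝ) 0) := by
  rintro ⟨c₀, t₀⟩ ⟨-, ht₀⟩
  refine ContinuousAt.continuousWithinAt ?_
  have hsub : ∀ c, ∀ t ∈ Ioo (-1 : ℝ) 0, iteratedDeriv j (realData 2 c) t =
      iteratedDeriv j (realData 2 c₀) t + iteratedDeriv j (realData 0 (c - c₀)) t := by
    intro c t ht
    have e : realData 2 c =ᶠ[𝓝 t] realData 2 c₀ + realData 0 (c - c₀) := by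
      filter_upwards [Ioo_mem_nhds ht.1 ht.2] with s hs
      rw [Pi.add_apply, realData_eq, realData_eq, realData_eq, seqSeries_sub c c₀
        (mem_ball_zero_iff.1 (ofReal_mem_dataDomain hs).1).le, Complex.sub_re]
      ring
    rw [e.iteratedDeriv_eq, iteratedDeriv_add
      ((contDiffAt_realData 2 c₀ ht).of_le (by exact_mod_cast le_top))
      ((contDiffAt_realData 0 (c - c₀) ht).of_le (by exact_mod_cast le_top))]
  have hnhds : ∀ᶠ z : BddSeq × ℝ in 𝓝 (c₀, t₀), z.2 ∈ Ioo (-1 : ℝ) 0 :=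
    continuous_snd.continuousAt.eventually (Ioo_mem_nhds ht₀.1 ht₀.2)
  have h1 : Tendsto (fun z : BddSeq × ℝ => iteratedDeriv j (realData 2 c₀) z.2) (𝓝 (c₀, t₀))
      (𝓝 (iteratedDeriv j (realData 2 c₀) t₀)) :=
    ((contDiffAt_iteratedDeriv (contDiffAt_realData 2 c₀ ht₀) j).continuousAt).comp
      (continuous_snd.continuousAt (x := (c₀, t₀)))
  have h2 : Tendsto (fun z : BddSeq × ℝ => iteratedDeriv j (realData 0 (z.1 - c₀)) z.2)
      (𝓝 (c₀, t₀)) (𝓝 0) := by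
    have hb : Tendsto (fun z : BddSeq × ℝ => j.factorial * (16 / -z.2) ^ j * (2 * ‖z.1 - c₀‖))
        (𝓝 (c₀, t₀)) (𝓝 0) := by
      have : ContinuousAt (fun z : BddSeq × ℝ => j.factorial * (16 / -z.2) ^ j *
          (2 * ‖z.1 - c₀‖)) (c₀, t₀) := by
        have hne : -(c₀, t₀).2 ≠ 0 := by simpa using ht₀.2.ne
        fun_prop (disch := assumption)
      simpa [ContinuousAt] using this
    refine squeeze_zero_norm' ?_ hb
    filter_upwards [hnhds] with z hz
    refine (abs_iteratedDeriv_realData_le le_rfl (z.1 - c₀) hz j).trans ?_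
    have hp : 0 < -z.2 := by linarith [hz.2]
    have hx : Real.exp (-(2 * 1026 ^ 2 / z.2 ^ 4)) ≤ 1 := by
      rw [Real.exp_le_one_iff]
      have : 0 ≤ 2 * 1026 ^ 2 / z.2 ^ 4 := by positivity
      linarith
    have h3 : Real.exp (-(2 * 1026 ^ 2 / z.2 ^ 4)) * (0 + 2 * ‖z.1 - c₀‖) ≤ 2 * ‖z.1 - c₀‖ := by
      rw [zero_add]
      exact mul_le_of_le_one_left (by positivity) hx
    gcongr
  have h3 := h1.add h2
  rw [add_zero] at h3
  exact h3.congr' (hnhds.mono fun z hz => (hsub z.1 z.2 hz).symm)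

end Data

/-! ### Continuous dependence of the coefficients on the parameter -/

section JointSmoothness

/-- A family of functions of `t ∈ (-1, 0)` which are smooth and depend continuously on the parameter
together with all their derivatives. -/
def JointlySmooth (f : BddSeq → ℝ → ℝ) : Prop :=
  (∀ c, ∀ t ∈ Ioo (-1 : ℝ) 0, ContDiffAt ℝ ∞ (f c) t) ∧
    ∀ j : ℕ, ContinuousOn (fun z : BddSeq × ℝ => iteratedDeriv j (f z.1) z.2)
      (univ ×ˢ Ioo (-1 : ℝ) 0)

namespace JointlySmooth

variable {f g : BddSeq → ℝ → ℝ}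

theorem of_contDiffAt {h : ℝ → ℝ} (hh : ∀ t ∈ Ioo (-1 : ℝ) 0, ContDiffAt ℝ ∞ h t) :
    JointlySmooth fun _ => h :=
  ⟨fun _ => hh, fun j z hz => (ContinuousAt.comp (f := Prod.snd)
    (contDiffAt_iteratedDeriv (hh z.2 hz.2) j).continuousAt
    continuous_snd.continuousAt).continuousWithinAt⟩

theorem add (hf : JointlySmooth f) (hg : JointlySmooth g) :
    JointlySmooth fun c => f c + g c := by
  refine ⟨fun c t ht => (hf.1 c t ht).add (hg.1 c t ht), fun j => ?_⟩
  refine ((hf.2 j).add (hg.2 j)).congr fun z hz => ?_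
  exact iteratedDeriv_add ((hf.1 z.1 z.2 hz.2).of_le (by exact_mod_cast le_top))
    ((hg.1 z.1 z.2 hz.2).of_le (by exact_mod_cast le_top))

theorem smul (hf : JointlySmooth f) (r : ℝ) : JointlySmooth fun c => r • f c := by
  refine ⟨fun c t ht => contDiffAt_const.smul (hf.1 c t ht), fun j => ?_⟩
  refine ((hf.2 j).const_smul r).congr fun z _ => ?_
  exact iteratedDeriv_const_smul_field r (f z.1)

theorem mul (hf : JointlySmooth f) (hg : JointlySmooth g) :
    JointlySmooth fun c => f c * g c := by
  refine ⟨fun c t ht => (hf.1 c t ht).mul (hg.1 c t ht), fun j => ?_⟩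
  have : ContinuousOn (fun z : BddSeq × ℝ => ∑ i ∈ Finset.range (j + 1), (j.choose i : ℝ) *
      iteratedDeriv i (f z.1) z.2 * iteratedDeriv (j - i) (g z.1) z.2)
      (univ ×ˢ Ioo (-1 : ℝ) 0) :=
    continuousOn_finsetSum _ fun i _ => (continuousOn_const.mul (hf.2 i)).mul (hg.2 (j - i))
  refine this.congr fun z hz => ?_
  exact iteratedDeriv_mul ((hf.1 z.1 z.2 hz.2).of_le (by exact_mod_cast le_top))
    ((hg.1 z.1 z.2 hz.2).of_le (by exact_mod_cast le_top))

theorem deriv (hf : JointlySmooth f) : JointlySmooth fun c => deriv (f c) := by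
  refine ⟨fun c t ht => (hf.1 c t ht).derivWithin (m := ∞) (by simp), fun j => ?_⟩
  simp only [← iteratedDeriv_succ']
  exact hf.2 (j + 1)

theorem sum {ι : Type*} (s : Finset ι) {F : ι → BddSeq → ℝ → ℝ}
    (h : ∀ i ∈ s, JointlySmooth (F i)) : JointlySmooth fun c => ∑ i ∈ s, F i c := by
  classical
  induction s using Finset.induction_on with
  | empty =>
    simp only [Finset.sum_empty]
    exact of_contDiffAt fun t _ => contDiffAt_const
  | insert i s hi ih =>
    simp only [Finset.sum_insert hi]
    exact (h i (Finset.mem_insert_self _ _)).add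
      (ih fun k hk => h k (Finset.mem_insert_of_mem hk))

theorem coeff_mul {F G : BddSeq → PowerSeries (ℝ → ℝ)} {n : ℕ}
    (hF : ∀ k ≤ n, JointlySmooth fun c => (F c).coeff k)
    (hG : ∀ k ≤ n, JointlySmooth fun c => (G c).coeff k) :
    ∀ k ≤ n, JointlySmooth fun c => (F c * G c).coeff k := by
  intro k hk
  simp only [PowerSeries.coeff_mul]
  exact sum _ fun p hp =>
    (hF _ ((Finset.HasAntidiagonal.antidiagonal.fst_le hp).trans hk)).mul
      (hG _ ((Finset.HasAntidiagonal.antidiagonal.snd_le hp).trans hk))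

end JointlySmooth

/-- The recursion uses only sums, products, scalars and `t`-derivatives, all of which preserve joint
smoothness. -/
theorem jointlySmooth_formalSolution {q a p : BddSeq → PowerSeries (ℝ → ℝ)}
    {h : BddSeq → ℝ → ℝ} (hh : JointlySmooth h)
    (H : ∀ c, FormalSolution (h c) (q c) (a c) (p c)) (n : ℕ) :
    ∀ k ≤ n, (JointlySmooth fun c => (q c).coeff k) ∧ (JointlySmooth fun c => (a c).coeff k) ∧
      JointlySmooth fun c => (p c).coeff k := by
  induction n with
  | zero =>
    intro k hk
    obtain rfl : k = 0 := by omega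
    simp only [(H _).q_zero, (H _).a_zero, (H _).p_zero]
    exact ⟨hh, .of_contDiffAt fun t _ => contDiffAt_const,
      .of_contDiffAt fun t ht => contDiffAt_const.mul (contDiffAt_inv ℝ ht.2.ne)⟩
  | succ n ih =>
    intro k hk
    rcases Nat.lt_or_ge k (n + 1) with hk' | hk'
    · exact ih k (by omega)
    obtain rfl : k = n + 1 := le_antisymm hk hk'
    have hq := fun k hk => (ih k hk).1
    have ha := fun k hk => (ih k hk).2.1
    have hp := fun k hk => (ih k hk).2.2
    have sm : ∀ (r : ℝ) (f : PowerSeries (ℝ → ℝ)) k, (r • f).coeff k = r • f.coeff k :=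
      fun _ _ _ => rfl
    have ha2 : ∀ k ≤ n, JointlySmooth fun c => (a c + (2 : ℝ) • 1).coeff k := by
      intro k hk
      simp only [map_add]
      refine (ha k hk).add (.of_contDiffAt fun t _ => ?_)
      rw [sm, PowerSeries.coeff_one]
      split_ifs
      · exact contDiffAt_const (c := (2 : ℝ) • (1 : ℝ))
      · exact contDiffAt_const (c := (2 : ℝ) • (0 : ℝ))
    have hN := JointlySmooth.coeff_mul hq (JointlySmooth.coeff_mul hq
      (JointlySmooth.coeff_mul ha2 hp)) n le_rfl
    have hM := JointlySmooth.coeff_mul hp (JointlySmooth.coeff_mul hp hq) n le_rfl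
    simp only [(H _).q_succ, (H _).a_succ, (H _).p_succ, map_add, sm]
    exact ⟨((ha n le_rfl).add (hN.smul _)).smul _, (hq n le_rfl).deriv.smul _, (hM.smul _).smul _⟩

theorem jointlySmooth_realData : JointlySmooth (realData 2) :=
  ⟨fun c _ ht => contDiffAt_realData 2 c ht, continuousOn_iteratedDeriv_realData⟩

end JointSmoothness

/-! ### Pointwise sums of series -/

section Evaluation

/-- The series `f` converges absolutely at `(x, t)` and has the sum `r`. -/
def EvalsTo (f : PowerSeries (ℝ → ℝ)) (x t r : ℝ) : Prop :=
  (Summable fun k => ‖f.coeff k t * x ^ k‖) ∧ seriesEval f x t = r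

namespace EvalsTo

variable {f g : PowerSeries (ℝ → ℝ)} {x t r s : ℝ}

theorem add (hf : EvalsTo f x t r) (hg : EvalsTo g x t s) : EvalsTo (f + g) x t (r + s) := by
  have e : ∀ k, (f + g).coeff k t * x ^ k = f.coeff k t * x ^ k + g.coeff k t * x ^ k :=
    fun k => by rw [map_add, Pi.add_apply, add_mul]
  refine ⟨?_, ?_⟩
  · simp only [e]
    exact (hf.1.add hg.1).of_nonneg_of_le (fun _ => norm_nonneg _) fun _ => norm_add_le _ _
  · rw [← hf.2, ← hg.2]
    unfold seriesEval
    rw [← hf.1.of_norm.tsum_add hg.1.of_norm]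
    exact tsum_congr e

theorem smul (hf : EvalsTo f x t r) (b : ℝ) : EvalsTo (b • f) x t (b * r) := by
  have e : ∀ k, (b • f).coeff k t * x ^ k = b * (f.coeff k t * x ^ k) :=
    fun k => by
      rw [show (b • f).coeff k = b • f.coeff k from rfl, Pi.smul_apply, smul_eq_mul, mul_assoc]
  refine ⟨?_, ?_⟩
  · simp only [e, norm_mul b]
    exact hf.1.mul_left _
  · rw [← hf.2]
    unfold seriesEval
    rw [← tsum_mul_left]
    exact tsum_congr e

theorem one : EvalsTo 1 x t 1 := by
  have e : ∀ k, k ≠ 0 → (1 : PowerSeries (ℝ → ℝ)).coeff k t * x ^ k = 0 := fun k hk => by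
    simp [PowerSeries.coeff_one, hk]
  refine ⟨summable_of_ne_finset_zero (s := {0}) fun k hk => ?_, ?_⟩
  · rw [e k (by simpa using hk), norm_zero]
  · unfold seriesEval
    rw [tsum_eq_single 0 e]
    simp

theorem mul (hf : EvalsTo f x t r) (hg : EvalsTo g x t s) : EvalsTo (f * g) x t (r * s) := by
  obtain ⟨h1, h2⟩ := SmoothlyConvergent.eval_mul_of_summable hf.1 hg.1
  exact ⟨h1, by rw [h2, hf.2, hg.2]⟩

end EvalsTo

end Evaluation

/-! ### From the first-order system back to the scalar equation -/

section Solution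

/-- The primitive in `x` of a power series. -/
noncomputable def primitive (q : PowerSeries (ℝ → ℝ)) : PowerSeries (ℝ → ℝ) :=
  PowerSeries.mk fun k => Nat.casesOn k (fun _ => 0) fun m => ((m + 1 : ℝ)⁻¹) • q.coeff m

theorem coeff_primitive_zero (q : PowerSeries (ℝ → ℝ)) : (primitive q).coeff 0 = fun _ => 0 :=
  PowerSeries.coeff_mk _ _

theorem coeff_primitive_succ (q : PowerSeries (ℝ → ℝ)) (k : ℕ) :
    (primitive q).coeff (k + 1) = ((k + 1 : ℝ)⁻¹) • q.coeff k :=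
  PowerSeries.coeff_mk _ _

theorem derivative_primitive (q : PowerSeries (ℝ → ℝ)) :
    PowerSeries.derivative (ℝ → ℝ) (primitive q) = q := by
  ext k : 1
  rw [SmoothlyConvergent.coeff_derivative_eq, coeff_primitive_succ, smul_smul,
    mul_inv_cancel₀ (by positivity), one_smul]

theorem SmoothlyConvergent.primitive {R : ℝ → ℝ} {q : PowerSeries (ℝ → ℝ)}
    (hq : SmoothlyConvergent R q) : SmoothlyConvergent R (primitive q) := by
  intro t₀ ht₀
  refine ⟨fun k => ?_, fun j ρ hρ hρR => ?_⟩
  · rcases k with _ | k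
    · rw [coeff_primitive_zero]; exact contDiffAt_const
    · rw [coeff_primitive_succ]; exact contDiffAt_const.smul ((hq t₀ ht₀).1 k)
  · obtain ⟨C, hC⟩ := (hq t₀ ht₀).2 j ρ hρ hρR
    have hC0 : 0 ≤ C := le_trans (by positivity) (hC.self_of_nhds 0)
    refine ⟨C * ρ, hC.mono fun t ht k => ?_⟩
    rcases k with _ | k
    · rw [coeff_primitive_zero, iteratedDeriv_const]
      simp only [ite_self, abs_zero, zero_mul]
      positivity
    · rw [coeff_primitive_succ, iteratedDeriv_const_smul_field, smul_eq_mul, abs_mul,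
        abs_of_pos (by positivity), pow_succ]
      have h1 : (k + 1 : ℝ)⁻¹ ≤ 1 := inv_le_one_of_one_le₀ (by linarith [Nat.cast_nonneg (α := ℝ) k])
      calc _ = (k + 1 : ℝ)⁻¹ * (|iteratedDeriv j (q.coeff k) t| * ρ ^ k * ρ) := by ring
        _ ≤ 1 * (C * ρ) := by gcongr; exact ht k
        _ = _ := one_mul _

/-- With `w` the primitive of `q`, this recovers `a = ∂ₜ w`; it holds at order `0` because `a`
vanishes at `x = 0`. -/
theorem FormalSolution.coeffDeriv_primitive {h : ℝ → ℝ} {q a p : PowerSeries (ℝ → ℝ)}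
    (H : FormalSolution h q a p) : coeffDeriv (primitive q) = a := by
  ext k : 1
  rw [coeffDeriv, PowerSeries.coeff_mk]
  rcases k with _ | k
  · rw [coeff_primitive_zero, H.a_zero]
    simp
  · rw [coeff_primitive_succ, H.a_succ]
    ext t
    exact deriv_const_smul_field _ _

theorem FormalSolution.derivative_q {h : ℝ → ℝ} {q a p : PowerSeries (ℝ → ℝ)}
    (H : FormalSolution h q a p) : PowerSeries.derivative (ℝ → ℝ) q =
      a + (1 / 4 : ℝ) • (q * (q * ((a + (2 : ℝ) • 1) * p))) := by
  ext k : 1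
  rw [SmoothlyConvergent.coeff_derivative_eq, H.q_succ, smul_smul,
    mul_inv_cancel₀ (by positivity), one_smul]

theorem FormalSolution.derivative_p {h : ℝ → ℝ} {q a p : PowerSeries (ℝ → ℝ)}
    (H : FormalSolution h q a p) : PowerSeries.derivative (ℝ → ℝ) p = -(p * (p * q)) := by
  ext k : 1
  rw [SmoothlyConvergent.coeff_derivative_eq, H.p_succ, smul_smul,
    mul_inv_cancel₀ (by positivity), one_smul, neg_one_smul]

/-- This recovers `p = 1/v`. The defect `Y = 1 - p V` solves the linear equation `∂ₓ Y = -(p q) Y`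
and vanishes at `x = 0`, hence to every order. -/
theorem FormalSolution.coeff_p_mul {h : ℝ → ℝ} {q a p : PowerSeries (ℝ → ℝ)}
    (H : FormalSolution h q a p) {t : ℝ} (ht : t ≠ 0) (k : ℕ) :
    (p * (PowerSeries.C (fun t : ℝ => -2 * t) + primitive q)).coeff k t =
      (1 : PowerSeries (ℝ → ℝ)).coeff k t := by
  set V := PowerSeries.C (fun t : ℝ => -2 * t) + primitive q with hV
  have dV : PowerSeries.derivative (ℝ → ℝ) V = q := by
    rw [hV, map_add, PowerSeries.derivative_C, derivative_primitive, zero_add]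
  have dY : PowerSeries.derivative (ℝ → ℝ) (1 - p * V) = -((p * q) * (1 - p * V)) := by
    rw [map_sub, PowerSeries.derivative_one, Derivation.leibniz, dV, H.derivative_p, smul_eq_mul,
      smul_eq_mul]
    ring
  suffices hY : ∀ n, ∀ k ≤ n, (1 - p * V).coeff k t = 0 by
    have := hY k k le_rfl
    rw [map_sub, Pi.sub_apply] at this
    linarith
  intro n
  induction n with
  | zero =>
    intro k hk
    obtain rfl : k = 0 := by omega
    have h0 : (p * V).coeff 0 = p.coeff 0 * V.coeff 0 := by simp [PowerSeries.coeff_mul]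
    rw [map_sub, Pi.sub_apply, h0, H.p_zero, hV, map_add,
      coeff_primitive_zero, PowerSeries.coeff_zero_C, PowerSeries.coeff_zero_one]
    simp
    field_simp
    norm_num
  | succ n ih =>
    intro k hk
    rcases Nat.lt_or_ge k (n + 1) with hk' | hk'
    · exact ih k (by omega)
    obtain rfl : k = n + 1 := le_antisymm hk hk'
    have h1 := congrArg (fun f : PowerSeries (ℝ → ℝ) => f.coeff n t) dY
    simp only [SmoothlyConvergent.coeff_derivative_eq, Pi.smul_apply, smul_eq_mul, map_neg,
      Pi.neg_apply] at h1
    have h2 : ((p * q) * (1 - p * V)).coeff n t = 0 := by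
      rw [PowerSeries.coeff_mul, Finset.sum_apply]
      refine Finset.sum_eq_zero fun i hi => ?_
      rw [Pi.mul_apply, ih i.2 (Finset.HasAntidiagonal.antidiagonal.snd_le hi), mul_zero]
    rw [h2, neg_zero] at h1
    exact (mul_eq_zero.1 h1).resolve_left (by positivity)

end Solution

/-! ### Quantitative bounds and choice of constants -/

section Bounds

/-- The growth `4^(k+j)` of `φ` and `(k+j).choose k ≤ 2^(k+j)` together cost a factor `8` per
derivative. -/
theorem Majorized.abs_iteratedDeriv_le {t α β K : ℝ} {k : ℕ} {f : PowerSeries (ℝ → ℝ)}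
    {φ : PowerSeries ℝ} (hα : 0 ≤ α) (hβ : 0 ≤ β) (hK : 0 ≤ K) (hf : Majorized t α β k f φ)
    (hφ : ∀ m, φ.coeff m ≤ K * 4 ^ m) (j : ℕ) :
    |iteratedDeriv j (f.coeff k) t| ≤ K * j.factorial * (8 * β) ^ j * (8 * α) ^ k := by
  have h1 := (hf k le_rfl).2 j
  have hk : (0 : ℝ) < k.factorial := by positivity
  refine le_of_mul_le_mul_right (h1.trans ?_) hk
  have hch : ((k + j).choose k : ℝ) ≤ 2 ^ (k + j) := by
    exact_mod_cast Nat.choose_le_two_pow (k + j) k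
  have hfac : ((k + j).factorial : ℝ) = (k + j).choose k * k.factorial * j.factorial := by
    have := Nat.choose_mul_factorial_mul_factorial (Nat.le_add_right k j)
    rw [Nat.add_sub_cancel_left] at this
    exact_mod_cast this.symm
  rw [hfac]
  calc _ ≤ α ^ k * β ^ j * ((k + j).choose k * k.factorial * j.factorial) *
        (K * 4 ^ (k + j)) := mul_le_mul_of_nonneg_left (hφ _) (by positivity)
    _ ≤ α ^ k * β ^ j * (2 ^ (k + j) * k.factorial * j.factorial) * (K * 4 ^ (k + j)) := by
        gcongr
    _ = _ := by
        rw [mul_pow, mul_pow, show (8 : ℝ) = 2 * 4 by norm_num, mul_pow, mul_pow, pow_add, pow_add]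
        ring

/-- Without `t`-derivatives there is no binomial loss. The rate `4α` instead of `8α` gives geometric
decay of ratio `1/2` on the whole width. -/
theorem Majorized.abs_coeff_le {t α β K : ℝ} {k : ℕ} {f : PowerSeries (ℝ → ℝ)}
    {φ : PowerSeries ℝ} (hα : 0 ≤ α) (hf : Majorized t α β k f φ)
    (hφ : ∀ m, φ.coeff m ≤ K * 4 ^ m) : |f.coeff k t| ≤ K * (4 * α) ^ k := by
  have h1 := (hf k le_rfl).2 0
  have hk : (0 : ℝ) < k.factorial := by positivity
  refine le_of_mul_le_mul_right ?_ hk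
  rw [iteratedDeriv_zero, add_zero, pow_zero, mul_one] at h1
  refine h1.trans ?_
  rw [mul_pow]
  calc _ ≤ α ^ k * k.factorial * (K * 4 ^ k) := by gcongr; exact hφ k
    _ = _ := by ring

/-- The half width of the surfaces at time `t`. -/
noncomputable def halfWidth (t : ℝ) : ℝ := (√(-t))⁻¹

theorem halfWidth_pos {t : ℝ} (ht : t < 0) : 0 < halfWidth t :=
  inv_pos.2 (Real.sqrt_pos.2 (by linarith))

theorem continuousOn_halfWidth : ContinuousOn halfWidth (Ioo (-1 : ℝ) 0) := by
  unfold halfWidth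
  refine ContinuousOn.inv₀ (by fun_prop) fun t ht => ?_
  exact (Real.sqrt_pos.2 (by linarith [ht.2])).ne'

theorem tendsto_halfWidth : Tendsto halfWidth (𝓝[<] 0) atTop := by
  refine tendsto_inv_nhdsGT_zero.comp (tendsto_nhdsWithin_iff.2 ⟨?_, ?_⟩)
  · have : ContinuousAt (fun t : ℝ => √(-t)) 0 := by fun_prop
    have h := this.tendsto
    rw [neg_zero, Real.sqrt_zero] at h
    exact h.mono_left nhdsWithin_le_nhds
  · filter_upwards [self_mem_nhdsWithin] with t ht
    exact Real.sqrt_pos.2 (neg_pos.2 ht)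

/-- With `y = (1026/τ²)² ≥ N²`, one factor `exp(-y)` absorbs `N^N ≤ exp(N²)`, and the other is at
most `1/y`, which beats `√τ τ`. The `4` bounds `2 + 2‖c‖`. -/
theorem four_mul_exp_le {τ : ℝ} (h0 : 0 < τ) (h1 : τ < 1) {N : ℕ} (hN : (N : ℝ) ≤ 1026 / τ ^ 2) :
    Real.exp (-(2 * 1026 ^ 2 / τ ^ 4)) * 4 ≤ √τ / 8 / (16 / τ) * (1 / 8) / (N : ℝ) ^ N := by
  set y : ℝ := 1026 ^ 2 / τ ^ 4 with hy
  have hy0 : 0 < y := by positivity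
  have hNN : (N : ℝ) ^ N ≤ Real.exp y := by
    have h2 : (N : ℝ) ≤ Real.exp N := by linarith [Real.add_one_le_exp (N : ℝ)]
    calc (N : ℝ) ^ N ≤ Real.exp N ^ N := by gcongr
      _ = Real.exp (N * N) := by rw [← Real.exp_nat_mul]
      _ ≤ Real.exp ((1026 / τ ^ 2) * (1026 / τ ^ 2)) := by gcongr
      _ = Real.exp y := by rw [hy]; congr 1; field_simp
  have hNpos : 0 < (N : ℝ) ^ N := by
    rcases Nat.eq_zero_or_pos N with h | h
    · simp [h]
    · positivity
  have hs : τ ≤ √τ := Real.le_sqrt_of_sq_le (by nlinarith)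
  have hexp : Real.exp (-y) ≤ 1 / y := by
    rw [Real.exp_neg, ← one_div]
    exact one_div_le_one_div_of_le hy0 (by linarith [Real.add_one_le_exp y])
  rw [le_div_iff₀ hNpos]
  have e1 : Real.exp (-(2 * 1026 ^ 2 / τ ^ 4)) = Real.exp (-y) * Real.exp (-y) := by
    rw [← Real.exp_add]; congr 1; rw [hy]; ring
  have e2 : √τ / 8 / (16 / τ) * (1 / 8) = √τ * τ / 1024 := by field_simp; norm_num
  rw [e1, e2]
  have h3 : Real.exp (-y) * (N : ℝ) ^ N ≤ 1 := by
    rw [Real.exp_neg, inv_mul_le_iff₀ (Real.exp_pos y), mul_one]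
    exact hNN
  calc _ = Real.exp (-y) * 4 * (Real.exp (-y) * (N : ℝ) ^ N) := by ring
    _ ≤ Real.exp (-y) * 4 * 1 := by gcongr
    _ ≤ 1 / y * 4 * 1 := by gcongr
    _ = τ ^ 4 * (4 / 1026 ^ 2) := by rw [hy]; field_simp
    _ ≤ (τ * τ) * (4 / 1026 ^ 2) := by
        gcongr
        have : τ ^ 2 ≤ 1 := by nlinarith
        nlinarith [mul_pos h0 h0]
    _ ≤ (√τ * τ) * (1 / 1024) :=
        mul_le_mul (mul_le_mul_of_nonneg_right hs h0.le) (by norm_num) (by norm_num)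
          (by positivity)
    _ = _ := by ring

theorem FormalSolution.exists_majorized {c : BddSeq} (hc : ‖c‖ < 1)
    {q a p : PowerSeries (ℝ → ℝ)} (H : FormalSolution (realData 2 c) q a p) {t : ℝ}
    (ht : t ∈ Ioo (-1 : ℝ) 0) : ∃ N : ℕ, 1 ≤ N ∧ ∀ n,
      Majorized t (√(-t) / 8) (16 / -t) n q
        ((√(-t) / 8 / (16 / -t) * (1 / 8)) • wcatSeries N) ∧
      Majorized t (√(-t) / 8) (16 / -t) n a ((1 / 8 : ℝ) • wcatSeries N) ∧
      Majorized t (√(-t) / 8) (16 / -t) n p ((-t)⁻¹ • catSeries) := by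
  have h0 : 0 < -t := by linarith [ht.2]
  have h1 : -t < 1 := by linarith [ht.1]
  have hsq : √(-t) ^ 2 = -t := Real.sq_sqrt h0.le
  -- `1024/(-t)²` is `β/α²`; the extra `1` covers the `α²` in `β + α² ≤ N α²`.
  set N := ⌈1024 / (-t) ^ 2⌉₊ + 1 with hN
  have hle : 1024 / (-t) ^ 2 ≤ (⌈1024 / (-t) ^ 2⌉₊ : ℝ) := Nat.le_ceil _
  have hlt := Nat.ceil_lt_add_one (by positivity : 0 ≤ 1024 / (-t) ^ 2)
  have hNc : (N : ℝ) = ⌈1024 / (-t) ^ 2⌉₊ + 1 := by rw [hN]; push_cast; rfl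
  have hN2 : (N : ℝ) ≤ 1026 / (-t) ^ 2 := by
    have : 1 ≤ 1 / (-t) ^ 2 := by rw [le_div_iff₀ (by positivity)]; nlinarith
    have e : 1026 / (-t) ^ 2 = 1024 / (-t) ^ 2 + 2 * (1 / (-t) ^ 2) := by ring
    rw [hNc, e]
    linarith
  refine ⟨N, by omega, H.majorized ht.2 (div_pos (Real.sqrt_pos.2 h0) (by norm_num))
    (div_mul_cancel₀ _ h0.ne') (by omega) ?_ (contDiffAt_realData 2 c ht) fun j => ?_⟩
  · rw [div_pow, hsq]
    have : 16 / -t = 1024 / (-t) ^ 2 * (-t / 8 ^ 2) := by field_simp; norm_num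
    rw [this, ← add_one_mul]
    refine mul_le_mul_of_nonneg_right ?_ (by positivity)
    rw [hNc]
    linarith
  · refine (abs_iteratedDeriv_realData_le (by norm_num) c ht j).trans ?_
    refine mul_le_mul_of_nonneg_left ?_ (by positivity)
    refine le_trans ?_ (four_mul_exp_le h0 h1 hN2)
    rw [show (-t) ^ 4 = t ^ 4 by ring]
    gcongr
    linarith

end Bounds

/-! ### The actual solutions -/

/-- The coefficients of a formal solution with one of the flat Cauchy data. -/
structure FlatSolution (c : BddSeq) (q a p : PowerSeries (ℝ → ℝ)) : Prop where
  norm_lt : ‖c‖ < 1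
  formal : FormalSolution (realData 2 c) q a p

namespace FlatSolution

variable {c : BddSeq} {q a p : PowerSeries (ℝ → ℝ)} {x t : ℝ}

theorem coeff_bounds (H : FlatSolution c q a p) (ht : t ∈ Ioo (-1 : ℝ) 0) (k : ℕ) :
    (ContDiffAt ℝ ∞ (q.coeff k) t ∧ ContDiffAt ℝ ∞ (p.coeff k) t) ∧
    |q.coeff k t| ≤ √(-t) * -t / 1024 * (√(-t) / 2) ^ k ∧
    ∀ j, |iteratedDeriv j (q.coeff k) t| * halfWidth t ^ k ≤
        √(-t) * -t / 1024 * j.factorial * (8 * (16 / -t)) ^ j ∧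
      |iteratedDeriv j (p.coeff k) t| * halfWidth t ^ k ≤
        (-t)⁻¹ * j.factorial * (8 * (16 / -t)) ^ j := by
  obtain ⟨N, hN, hM⟩ := H.formal.exists_majorized H.norm_lt ht
  have h0 : 0 < -t := by linarith [ht.2]
  have hs : 0 < √(-t) := Real.sqrt_pos.2 h0
  have e : √(-t) / 8 / (16 / -t) * (1 / 8) = √(-t) * -t / 1024 := by field_simp; ring
  obtain ⟨hq, -, hp⟩ := hM k
  rw [e] at hq
  have hφ : ∀ m, ((√(-t) * -t / 1024) • wcatSeries N).coeff m ≤ √(-t) * -t / 1024 * 4 ^ m := by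
    intro m
    rw [PowerSeries.coeff_smul, smul_eq_mul]
    exact mul_le_mul_of_nonneg_left (coeff_wcatSeries_le_pow hN m) (by positivity)
  have hγ : ∀ m, ((-t)⁻¹ • catSeries).coeff m ≤ (-t)⁻¹ * 4 ^ m := by
    intro m
    rw [PowerSeries.coeff_smul, smul_eq_mul]
    exact mul_le_mul_of_nonneg_left (coeff_catSeries_le_pow m) (by positivity)
  -- `α` was chosen so that `8α` is the reciprocal of the half width.
  have hw : (8 * (√(-t) / 8)) ^ k * halfWidth t ^ k = 1 := by
    rw [← mul_pow, halfWidth, mul_div_cancel₀ _ (by norm_num : (8 : ℝ) ≠ 0),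
      mul_inv_cancel₀ hs.ne', one_pow]
  have hwp := halfWidth_pos ht.2
  refine ⟨⟨(hq k le_rfl).1, (hp k le_rfl).1⟩, ?_, fun j => ⟨?_, ?_⟩⟩
  · have := hq.abs_coeff_le (by positivity) hφ
    rwa [show 4 * (√(-t) / 8) = √(-t) / 2 by ring] at this
  · refine (mul_le_mul_of_nonneg_right (hq.abs_iteratedDeriv_le (by positivity) (by positivity)
      (by positivity) hφ j) (by positivity)).trans (le_of_eq ?_)
    rw [mul_assoc, hw, mul_one]
  · refine (mul_le_mul_of_nonneg_right (hp.abs_iteratedDeriv_le (by positivity) (by positivity)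
      (by positivity) hγ j) (by positivity)).trans (le_of_eq ?_)
    rw [mul_assoc, hw, mul_one]

theorem smoothlyConvergent_q (H : FlatSolution c q a p) : SmoothlyConvergent halfWidth q := by
  refine .of_bound continuousOn_halfWidth (fun t ht k => (H.coeff_bounds ht k).1.1)
    (fun j t => √(-t) * -t / 1024 * j.factorial * (8 * (16 / -t)) ^ j) (fun j => ?_)
    fun t ht j k => ((H.coeff_bounds ht k).2.2 j).1
  have : ∀ t ∈ Ioo (-1 : ℝ) 0, -t ≠ 0 := fun t ht => by simpa using ht.2.ne
  fun_prop (disch := assumption)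

theorem smoothlyConvergent_p (H : FlatSolution c q a p) : SmoothlyConvergent halfWidth p := by
  refine .of_bound continuousOn_halfWidth (fun t ht k => (H.coeff_bounds ht k).1.2)
    (fun j t => (-t)⁻¹ * j.factorial * (8 * (16 / -t)) ^ j) (fun j => ?_)
    fun t ht j k => ((H.coeff_bounds ht k).2.2 j).2
  have : ∀ t ∈ Ioo (-1 : ℝ) 0, -t ≠ 0 := fun t ht => by simpa using ht.2.ne
  fun_prop (disch := assumption)

theorem smoothlyConvergent_a (H : FlatSolution c q a p) : SmoothlyConvergent halfWidth a :=
  H.formal.coeffDeriv_primitive ▸ H.smoothlyConvergent_q.primitive.coeffDeriv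

theorem abs_lt_of_mem (hz : (x, t) ∈ planeRegion halfWidth) : √(-t) * |x| < 1 := by
  have hs : 0 < √(-t) := Real.sqrt_pos.2 (by linarith [hz.1.2])
  have h := mul_lt_mul_of_pos_left hz.2 hs
  rwa [halfWidth, mul_inv_cancel₀ hs.ne'] at h

theorem abs_coeff_q_mul_le (H : FlatSolution c q a p) (hz : (x, t) ∈ planeRegion halfWidth)
    (k : ℕ) : ‖q.coeff k t * x ^ k‖ ≤ √(-t) * -t / 1024 * (1 / 2) ^ k := by
  have h0 : 0 < -t := by linarith [hz.1.2]
  have h1 := (H.coeff_bounds hz.1 k).2.1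
  have h2 := abs_lt_of_mem hz
  rw [norm_mul, norm_pow, Real.norm_eq_abs, Real.norm_eq_abs]
  calc _ ≤ √(-t) * -t / 1024 * (√(-t) / 2) ^ k * |x| ^ k := by gcongr
    _ = √(-t) * -t / 1024 * (√(-t) * |x| / 2) ^ k := by rw [mul_assoc, ← mul_pow]; ring
    _ ≤ _ := by gcongr

/-- Integration in `x` costs a factor `|x|`, which the `√(-t)` in the bound for `q` absorbs. -/
theorem abs_coeff_primitive_mul_le (H : FlatSolution c q a p)
    (hz : (x, t) ∈ planeRegion halfWidth) (k : ℕ) :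
    ‖(primitive q).coeff k t * x ^ k‖ ≤ -t / 512 * (1 / 2) ^ k := by
  have h0 : 0 < -t := by linarith [hz.1.2]
  rcases k with _ | k
  · rw [coeff_primitive_zero]
    simp
    linarith
  · have h1 := H.abs_coeff_q_mul_le hz k
    have h2 := abs_lt_of_mem hz
    have h3 : (k + 1 : ℝ)⁻¹ ≤ 1 := inv_le_one_of_one_le₀ (by linarith [Nat.cast_nonneg (α := ℝ) k])
    rw [coeff_primitive_succ, Pi.smul_apply, smul_eq_mul, pow_succ]
    calc _ = (k + 1 : ℝ)⁻¹ * (‖q.coeff k t * x ^ k‖ * |x|) := by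
          rw [← Real.norm_eq_abs x, ← norm_mul, show (k + 1 : ℝ)⁻¹ * q.coeff k t * (x ^ k * x) =
            (k + 1 : ℝ)⁻¹ * (q.coeff k t * x ^ k * x) by ring, norm_mul, Real.norm_eq_abs
            ((k + 1 : ℝ)⁻¹), abs_of_pos (by positivity)]
      _ ≤ 1 * (√(-t) * -t / 1024 * (1 / 2) ^ k * |x|) := by gcongr
      _ = (-t / 1024 * (1 / 2) ^ k) * (√(-t) * |x|) := by ring
      _ ≤ (-t / 1024 * (1 / 2) ^ k) * 1 := by gcongr
      _ = _ := by rw [pow_succ]; ring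

theorem abs_eval_q_le (H : FlatSolution c q a p) (hz : (x, t) ∈ planeRegion halfWidth) :
    |seriesEval q x t| ≤ √(-t) * -t / 512 := by
  have h := tsum_of_norm_bounded (summable_half.mul_left _).hasSum (H.abs_coeff_q_mul_le hz)
  rw [tsum_mul_left, tsum_geometric_two] at h
  refine h.trans (le_of_eq ?_)
  ring

theorem abs_eval_primitive_le (H : FlatSolution c q a p)
    (hz : (x, t) ∈ planeRegion halfWidth) : |seriesEval (primitive q) x t| ≤ -t / 256 := by
  have h := tsum_of_norm_bounded (summable_half.mul_left _).hasSum
    (H.abs_coeff_primitive_mul_le hz)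
  rw [tsum_mul_left, tsum_geometric_two] at h
  refine h.trans (le_of_eq ?_)
  ring

end FlatSolution

/-- The square of the radius, `-2 t + w`. -/
noncomputable def sqRadius (q : PowerSeries (ℝ → ℝ)) (x t : ℝ) : ℝ :=
  -2 * t + seriesEval (primitive q) x t

namespace FlatSolution

variable {c : BddSeq} {q a p : PowerSeries (ℝ → ℝ)} {x t : ℝ}

theorem le_sqRadius (H : FlatSolution c q a p) (hz : (x, t) ∈ planeRegion halfWidth) :
    -t ≤ sqRadius q x t := by
  have h := (abs_le.1 (H.abs_eval_primitive_le hz)).1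
  have := hz.1.2
  simp only [sqRadius] at *
  linarith

theorem sqRadius_le (H : FlatSolution c q a p) (hz : (x, t) ∈ planeRegion halfWidth) :
    sqRadius q x t ≤ -3 * t := by
  have h := (abs_le.1 (H.abs_eval_primitive_le hz)).2
  have := hz.1.2
  simp only [sqRadius] at *
  linarith

theorem sqRadius_pos (H : FlatSolution c q a p) (hz : (x, t) ∈ planeRegion halfWidth) :
    0 < sqRadius q x t :=
  lt_of_lt_of_le (neg_pos.2 hz.1.2) (H.le_sqRadius hz)

theorem hasDerivAt_sqRadius_fst (H : FlatSolution c q a p)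
    (hz : (x, t) ∈ planeRegion halfWidth) :
    HasDerivAt (fun y => sqRadius q y t) (seriesEval q x t) x := by
  have h := (H.smoothlyConvergent_q.primitive.hasDerivAt_fst hz).const_add (-2 * t)
  rwa [derivative_primitive] at h

theorem hasDerivAt_sqRadius_snd (H : FlatSolution c q a p)
    (hz : (x, t) ∈ planeRegion halfWidth) :
    HasDerivAt (fun s => sqRadius q x s) (-2 + seriesEval a x t) t := by
  have h := H.smoothlyConvergent_q.primitive.hasDerivAt_snd hz
  rw [H.formal.coeffDeriv_primitive] at h
  have h2 := ((hasDerivAt_id t).const_mul (-2)).add h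
  rw [mul_one] at h2
  exact h2

theorem eval_p (H : FlatSolution c q a p) (hz : (x, t) ∈ planeRegion halfWidth) :
    seriesEval p x t * sqRadius q x t = 1 := by
  have hC : EvalsTo (PowerSeries.C (fun t : ℝ => -2 * t)) x t (-2 * t) := by
    have e : ∀ k, k ≠ 0 → (PowerSeries.C (fun t : ℝ => -2 * t)).coeff k t * x ^ k = 0 :=
      fun k hk => by simp [PowerSeries.coeff_C, hk]
    refine ⟨summable_of_ne_finset_zero (s := {0}) fun k hk => ?_, ?_⟩
    · rw [e k (by simpa using hk), norm_zero]
    · unfold seriesEval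
      rw [tsum_eq_single 0 e]
      simp
  have hp : EvalsTo p x t (seriesEval p x t) := ⟨H.smoothlyConvergent_p.summable hz, rfl⟩
  have hw : EvalsTo (primitive q) x t (seriesEval (primitive q) x t) :=
    ⟨H.smoothlyConvergent_q.primitive.summable hz, rfl⟩
  have h := (hp.mul (hC.add hw)).2
  rw [sqRadius, ← h, ← (EvalsTo.one (x := x) (t := t)).2]
  exact tsum_congr fun k => by rw [H.formal.coeff_p_mul hz.1.2.ne]

theorem hasDerivAt_eval_q (H : FlatSolution c q a p) (hz : (x, t) ∈ planeRegion halfWidth) :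
    HasDerivAt (fun y => seriesEval q y t) (seriesEval a x t + seriesEval q x t ^ 2 *
      (seriesEval a x t + 2) / (4 * sqRadius q x t)) x := by
  have h := H.smoothlyConvergent_q.hasDerivAt_fst hz
  have hq : EvalsTo q x t (seriesEval q x t) := ⟨H.smoothlyConvergent_q.summable hz, rfl⟩
  have ha : EvalsTo a x t (seriesEval a x t) := ⟨H.smoothlyConvergent_a.summable hz, rfl⟩
  have hp : EvalsTo p x t (seriesEval p x t) := ⟨H.smoothlyConvergent_p.summable hz, rfl⟩
  have e := (ha.add ((hq.mul (hq.mul ((ha.add (EvalsTo.one.smul 2)).mul hp))).smul (1 / 4))).2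
  rw [H.formal.derivative_q, e] at h
  have hv := H.sqRadius_pos hz
  have hpv : seriesEval p x t = (sqRadius q x t)⁻¹ :=
    eq_inv_of_mul_eq_one_left (H.eval_p hz)
  rw [hpv] at h
  convert! h using 1
  field_simp

theorem eval_q_zero (H : FlatSolution c q a p) : seriesEval q 0 t = realData 2 c t := by
  rw [seriesEval, tsum_eq_single 0 fun k hk => by simp [hk], H.formal.q_zero]
  simp

theorem contDiffOn_sqRadius (H : FlatSolution c q a p) :
    ContDiffOn ℝ ∞ (fun z : ℝ × ℝ => sqRadius q z.1 z.2) (planeRegion halfWidth) :=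
  (contDiffOn_const.mul contDiffOn_snd).add
    (H.smoothlyConvergent_q.primitive.contDiffOn continuousOn_halfWidth)

theorem mem_planeRegion_nhds (hz : (x, t) ∈ planeRegion halfWidth) :
    ∀ᶠ y in 𝓝 x, (y, t) ∈ planeRegion halfWidth :=
  (Continuous.prodMk_left t).continuousAt.eventually
    ((isOpen_planeRegion continuousOn_halfWidth).mem_nhds hz)

/-- By the equation for `∂ₓ q`, the second derivative of `ρ = √v` takes the form `a (1 + ρ'²) /
(2ρ)`, so that `ρ'' / (1 + ρ'²)` is simply `a / (2ρ)`. -/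
theorem profileAt (H : FlatSolution c q a p) (hz : (x, t) ∈ planeRegion halfWidth) :
    ProfileAt (fun y => √(sqRadius q y t))
      (fun y => seriesEval q y t / (2 * √(sqRadius q y t)))
      (seriesEval a x t * (1 + (seriesEval q x t / (2 * √(sqRadius q x t))) ^ 2) /
        (2 * √(sqRadius q x t))) x := by
  have hv := H.sqRadius_pos hz
  have hs : 0 < √(sqRadius q x t) := Real.sqrt_pos.2 hv
  have hsq : sqRadius q x t = √(sqRadius q x t) ^ 2 := (Real.sq_sqrt hv.le).symm
  have hd : ∀ y, (y, t) ∈ planeRegion halfWidth → HasDerivAt (fun y => √(sqRadius q y t))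
      (seriesEval q y t / (2 * √(sqRadius q y t))) y := fun y hy =>
    (H.hasDerivAt_sqRadius_fst hy).sqrt (H.sqRadius_pos hy).ne'
  refine ⟨hs, (mem_planeRegion_nhds hz).mono hd, ?_⟩
  have h := (H.hasDerivAt_eval_q hz).div ((hd x hz).const_mul 2) (by positivity)
  convert! h using 1
  generalize √(sqRadius q x t) = s at *
  rw [hsq]
  field_simp
  ring

theorem hasDerivAt_radius_snd (H : FlatSolution c q a p)
    (hz : (x, t) ∈ planeRegion halfWidth) :
    HasDerivAt (fun s => √(sqRadius q x s))
      ((-2 + seriesEval a x t) / (2 * √(sqRadius q x t))) t :=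
  (H.hasDerivAt_sqRadius_snd hz).sqrt (H.sqRadius_pos hz).ne'

/-- Here `ρ² ≤ -3t` and `ρ'² = q²/(4v) ≤ 1`. -/
theorem le_normSqSecondForm (H : FlatSolution c q a p) (hz : (x, t) ∈ planeRegion halfWidth)
    (θ : ℝ) : 1 / (-6 * t) ≤
      normSqSecondForm (revSurface fun y => √(sqRadius q y t)) x θ := by
  refine le_trans ?_ ((H.profileAt hz).le_normSqSecondForm θ)
  have hv := H.sqRadius_pos hz
  have h1 := H.le_sqRadius hz
  have h2 := H.sqRadius_le hz
  have h3 := H.abs_eval_q_le hz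
  have ht0 : 0 < -t := by linarith [hz.1.2]
  have ht1 : -t < 1 := by linarith [hz.1.1]
  rw [div_pow, mul_pow, Real.sq_sqrt hv.le]
  have hq2 : seriesEval q x t ^ 2 ≤ sqRadius q x t := by
    have hs1 : √(-t) ≤ 1 := Real.sqrt_le_one.2 ht1.le
    have hs0 : 0 ≤ √(-t) := Real.sqrt_nonneg _
    have h4 : |seriesEval q x t| ≤ -t := h3.trans (by nlinarith)
    rw [← sq_abs]
    nlinarith [abs_nonneg (seriesEval q x t)]
  have h5 : seriesEval q x t ^ 2 / (2 ^ 2 * sqRadius q x t) ≤ 1 :=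
    div_le_one_of_le₀ (by linarith) (by positivity)
  refine one_div_le_one_div_of_le (by positivity) ?_
  calc _ ≤ -3 * t * (1 + 1) := by gcongr; linarith
    _ = _ := by ring

end FlatSolution

/-! ### The flow, its slices and its singular set -/

/-- The height, over the cylinder of radius `√(-2 t)`, of the surface of revolution of radius
`√(sqRadius q x t)`. -/
noncomputable def graphHeight (q : PowerSeries (ℝ → ℝ)) (x _θ t : ℝ) : ℝ :=
  √(sqRadius q x t) - √(-2 * t)

theorem cylGraph_graphHeight (q : PowerSeries (ℝ → ℝ)) (x θ t : ℝ) :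
    cylGraph (graphHeight q) x θ t = revSurface (fun y => √(sqRadius q y t)) x θ := by
  simp only [cylGraph, graphHeight, revSurface, add_sub_cancel]

namespace FlatSolution

variable {c c' : BddSeq} {q a p q' a' p' : PowerSeries (ℝ → ℝ)} {x t : ℝ}

theorem isMeanCurvatureFlow (H : FlatSolution c q a p) :
    IsMeanCurvatureFlow (cylGraph (graphHeight q)) (region halfWidth) := by
  have hF : ∀ t, (fun y η => cylGraph (graphHeight q) y η t) =
      revSurface fun y => √(sqRadius q y t) :=
    fun t => funext fun y => funext fun η => cylGraph_graphHeight q y η t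
  refine ⟨?_, fun x θ t hz => ?_, fun x θ t hz => ?_⟩
  · have hρ : ContDiffOn ℝ ∞ (fun z : ℝ × ℝ × ℝ => √(sqRadius q z.1 z.2.2))
        (region halfWidth) := by
      refine ContDiffOn.sqrt ?_ fun z hz => (H.sqRadius_pos (x := z.1) (t := z.2.2) hz).ne'
      exact H.contDiffOn_sqRadius.comp
        (contDiff_fst.prodMk (contDiff_snd.comp contDiff_snd)).contDiffOn fun z hz => hz
    have hθ : ContDiff ℝ ∞ fun z : ℝ × ℝ × ℝ => z.2.1 := contDiff_fst.comp contDiff_snd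
    simp only [cylGraph_graphHeight, revSurface]
    rw [contDiffOn_euclidean]
    intro i
    fin_cases i
    · simpa using! contDiff_fst.contDiffOn
    · simpa using! hρ.mul (Real.contDiff_cos.comp hθ).contDiffOn
    · simpa using! hρ.mul (Real.contDiff_sin.comp hθ).contDiffOn
  · rw [hF]
    exact (H.profileAt (x := x) (t := t) hz).linearIndependent θ
  · have hz' : (x, t) ∈ planeRegion halfWidth := hz
    have hP := H.profileAt hz'
    have hd := H.hasDerivAt_radius_snd hz'
    have hv : deriv (fun s => cylGraph (graphHeight q) x θ s) t =
        ((-2 + seriesEval a x t) / (2 * √(sqRadius q x t))) • radial θ := by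
      simp only [cylGraph_graphHeight, revSurface]
      rw [(hasDerivAt_vec3 (hasDerivAt_const t x) (hd.mul_const _) (hd.mul_const _)).deriv]
      ext i
      fin_cases i <;> simp [radial]
    -- Both sides become multiples of `radialNormal`, and the factors agree: `ρ_t = (a - 2)/(2ρ) =
    -- a/(2ρ) - 1/ρ`.
    rw [hF, hv, hP.normalPart_smul_radial, hP.meanCurvatureVector_eq]
    congr 1
    have hs : 0 < √(sqRadius q x t) := Real.sqrt_pos.2 (H.sqRadius_pos hz')
    generalize √(sqRadius q x t) = s at *
    field_simp
    ring

theorem isLocalGraphFlow (H : FlatSolution c q a p) :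
    IsLocalGraphFlow halfWidth (graphHeight q) where
  periodic _ _ _ := rfl
  radius_pos x θ t hz := by
    simp only [graphHeight, add_sub_cancel]
    exact Real.sqrt_pos.2 (H.sqRadius_pos (x := x) (t := t) hz)
  flow := H.isMeanCurvatureFlow

/-- Lets a slice, as a mere set, determine the function `v`. -/
theorem sq_eq_of_mem_slice (H : FlatSolution c q a p) {r : ℝ}
    (hz : (x, t) ∈ planeRegion halfWidth)
    (hr : (!₂[x, r, 0] : E3) ∈ slice halfWidth (graphHeight q) t) : sqRadius q x t = r ^ 2 := by
  obtain ⟨y, θ, -, he⟩ := hr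
  rw [cylGraph_graphHeight, revSurface] at he
  have h0 := congrArg (fun p : E3 => p 0) he
  have h1 := congrArg (fun p : E3 => p 1) he
  have h2 := congrArg (fun p : E3 => p 2) he
  simp at h0 h1 h2
  subst h0
  have hv := H.sqRadius_pos hz
  have hne : √(sqRadius q x t) ≠ 0 := (Real.sqrt_pos.2 hv).ne'
  have hsin : Real.sin θ = 0 := by
    rcases h2 with h2 | h2
    · exact absurd h2 hne
    · exact h2
  have hsc := Real.sin_sq_add_cos_sq θ
  rw [hsin] at hsc
  rw [h1, mul_pow, Real.sq_sqrt hv.le]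
  linear_combination -(sqRadius q x t) * hsc

theorem mem_slice (hx : |x| < halfWidth t) :
    (!₂[x, √(sqRadius q x t), 0] : E3) ∈ slice halfWidth (graphHeight q) t :=
  ⟨x, 0, hx, by rw [cylGraph_graphHeight, revSurface]; simp⟩

theorem zero_mem_planeRegion (ht : t ∈ Ioo (-1 : ℝ) 0) : ((0 : ℝ), t) ∈ planeRegion halfWidth :=
  ⟨ht, by simpa using halfWidth_pos ht.2⟩

/-- In a product `v` would be constant in `x` near `0`, against `∂ₓ v = h(t) > 0` at `x = 0`. -/
theorem not_isProductSlice (H : FlatSolution c q a p) (ht : t ∈ Ioo (-1 : ℝ) 0) :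
    ¬ IsProductSlice halfWidth (graphHeight q) t := by
  rintro ⟨S, hS⟩
  have hz := zero_mem_planeRegion ht
  have h0 : (!₂[(0 : ℝ), √(sqRadius q 0 t), 0] : E3) ∈ slice halfWidth (graphHeight q) t :=
    mem_slice hz.2
  rw [hS] at h0
  have h1 : ∀ᶠ y in 𝓝 (0 : ℝ), sqRadius q y t = sqRadius q 0 t := by
    filter_upwards [mem_planeRegion_nhds hz] with y hy
    have hm : (!₂[y, √(sqRadius q 0 t), 0] : E3) ∈ slice halfWidth (graphHeight q) t := by
      rw [hS]
      exact ⟨by simpa using hy.2, by simpa using h0.2⟩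
    rw [H.sq_eq_of_mem_slice hy hm, Real.sq_sqrt (H.sqRadius_pos hz).le]
  have h2 := (H.hasDerivAt_sqRadius_fst hz).unique
    ((hasDerivAt_const (0 : ℝ) (sqRadius q 0 t)).congr_of_eventuallyEq h1)
  rw [H.eval_q_zero] at h2
  exact (realData_pos H.norm_lt ht).ne' h2

theorem realData_eq_of_slice_eq (H : FlatSolution c q a p) (H' : FlatSolution c' q' a' p')
    (ht : t ∈ Ioo (-1 : ℝ) 0)
    (h : slice halfWidth (graphHeight q) t = slice halfWidth (graphHeight q') t) :
    realData 2 c t = realData 2 c' t := by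
  have hz := zero_mem_planeRegion ht
  have h1 : ∀ᶠ y in 𝓝 (0 : ℝ), sqRadius q y t = sqRadius q' y t := by
    filter_upwards [mem_planeRegion_nhds hz] with y hy
    have hm : (!₂[y, √(sqRadius q y t), 0] : E3) ∈ slice halfWidth (graphHeight q') t :=
      h ▸ mem_slice hy.2
    rw [H'.sq_eq_of_mem_slice hy hm, Real.sq_sqrt (H.sqRadius_pos hy).le]
  have h2 := (H.hasDerivAt_sqRadius_fst hz).unique
    ((H'.hasDerivAt_sqRadius_fst hz).congr_of_eventuallyEq h1)
  rwa [H.eval_q_zero, H'.eval_q_zero] at h2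

/-- Since `v ≤ -3t`, the surfaces leave every neighbourhood of a point off the axis. Conversely the
width tends to infinity, so every axis point is approached, with `|A|² ≥ 1/(-6t)`. -/
theorem singularSet_eq (H : FlatSolution c q a p) :
    singularSet (cylGraph (graphHeight q)) (region halfWidth) = axis := by
  have hF : ∀ t, (fun y η => cylGraph (graphHeight q) y η t) =
      revSurface fun y => √(sqRadius q y t) :=
    fun t => funext fun y => funext fun η => cylGraph_graphHeight q y η t
  ext z
  constructor
  · intro hz
    have key : ∀ ε > 0, ε ≤ 1 → z 1 ^ 2 + z 2 ^ 2 ≤ 2 * (3 * ε) + 4 * ε ^ 2 := by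
      intro ε hε hε1
      obtain ⟨x, θ, t, hD, ht, ht0, hd, -⟩ := hz 0 ε hε
      have hD' : (x, t) ∈ planeRegion halfWidth := hD
      have hv := H.sqRadius_pos hD'
      have hv2 := H.sqRadius_le hD'
      rw [cylGraph_graphHeight, revSurface] at hd
      have hc : ∀ i, |(!₂[x, √(sqRadius q x t) * Real.cos θ, √(sqRadius q x t) * Real.sin θ] : E3) i
          - z i| < ε := fun i => by
        rw [dist_eq_norm] at hd
        refine lt_of_le_of_lt ?_ hd
        rw [← Real.norm_eq_abs, ← PiLp.sub_apply]
        exact PiLp.norm_apply_le _ i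
      have h1 := hc 1
      have h2 := hc 2
      simp only [Fin.isValue, Matrix.cons_val_one, Matrix.cons_val_zero,
        Matrix.cons_val] at h1 h2
      have hsc := Real.sin_sq_add_cos_sq θ
      have hs2 := Real.sq_sqrt hv.le
      set s := √(sqRadius q x t)
      have e1 := sq_lt_sq' (abs_lt.1 h1).1 (abs_lt.1 h1).2
      have e2 := sq_lt_sq' (abs_lt.1 h2).1 (abs_lt.1 h2).2
      have e3 : (s * Real.cos θ) ^ 2 + (s * Real.sin θ) ^ 2 ≤ 3 * ε := by
        have : (s * Real.cos θ) ^ 2 + (s * Real.sin θ) ^ 2 = s ^ 2 := by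
          linear_combination s ^ 2 * hsc
        rw [this, hs2]
        linarith
      -- This is `|z|² ≤ 2|y|² + 2|z - y|²` in the last two coordinates, `y` being the nearby point
      -- of the surface.
      nlinarith [sq_nonneg (2 * (s * Real.cos θ) - z 1), sq_nonneg (2 * (s * Real.sin θ) - z 2)]
    have hle : z 1 ^ 2 + z 2 ^ 2 ≤ 0 := by
      by_contra hpos
      push Not at hpos
      set m := z 1 ^ 2 + z 2 ^ 2
      -- With `ε ≤ 1` and `ε ≤ m/20`, `6ε + 4ε² ≤ 10ε ≤ m/2 < m`.
      have := key (min 1 (m / 20)) (lt_min one_pos (by positivity)) (min_le_left _ _)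
      have h1 : min 1 (m / 20) ≤ 1 := min_le_left _ _
      have h2 : min 1 (m / 20) ≤ m / 20 := min_le_right _ _
      have h3 : 0 < min 1 (m / 20) := lt_min one_pos (by positivity)
      nlinarith
    exact ⟨by nlinarith [sq_nonneg (z 1), sq_nonneg (z 2)],
      by nlinarith [sq_nonneg (z 1), sq_nonneg (z 2)]⟩
  · rintro ⟨hz1, hz2⟩ C ε hε
    have ev1 : ∀ᶠ t : ℝ in 𝓝[<] 0, |z 0| < halfWidth t :=
      tendsto_halfWidth.eventually (eventually_gt_atTop _)
    -- The thresholds stand for the life span of the flow, the time window, the distance `√v ≤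
    -- √(-3t) < ε`, and the curvature `1/(-6t) > C`.
    have hm : max (max (-1) (-ε)) (max (-(ε ^ 2 / 3)) (-(1 / (6 * (|C| + 1))))) < (0 : ℝ) := by
      have : 0 < |C| + 1 := by positivity
      refine max_lt (max_lt (by norm_num) (by linarith)) (max_lt ?_ ?_)
      · rw [neg_lt_zero]; positivity
      · rw [neg_lt_zero]; positivity
    obtain ⟨t, ht1, ht2⟩ := (ev1.and (Ioo_mem_nhdsLT hm)).exists
    obtain ⟨hta, htb⟩ := ht2
    simp only [max_lt_iff] at hta
    obtain ⟨⟨hta1, hta2⟩, hta3, hta4⟩ := hta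
    have hD : (z 0, t) ∈ planeRegion halfWidth := ⟨⟨hta1, htb⟩, ht1⟩
    have hv := H.sqRadius_pos hD
    have hv2 := H.sqRadius_le hD
    refine ⟨z 0, 0, t, hD, hta2, htb, ?_, ?_⟩
    · rw [cylGraph_graphHeight, revSurface, EuclideanSpace.dist_eq, Fin.sum_univ_three]
      simp [hz1, hz2, abs_of_nonneg (Real.sqrt_nonneg _)]
      rw [Real.sqrt_lt' hε]
      linarith
    · rw [hF]
      refine lt_of_lt_of_le ?_ (H.le_normSqSecondForm hD 0)
      have hp : 0 < -6 * t := by linarith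
      rw [lt_div_iff₀ hp]
      have hC1 : 0 < |C| + 1 := by positivity
      have h4 : -6 * t * (|C| + 1) < 1 := by
        have : -t < 1 / (6 * (|C| + 1)) := by linarith
        rw [lt_div_iff₀ (by positivity)] at this
        linarith
      nlinarith [le_abs_self C]

end FlatSolution

/-! ### Joint continuity and conclusion -/

/-- The coefficients are continuous in `(c, t)`, and the geometric bound on the terms is uniform
over the unit ball and the region, so the Weierstrass test applies. -/
theorem continuousOn_graphHeight {q a p : BddSeq → PowerSeries (ℝ → ℝ)}
    (H : ∀ c, FormalSolution (realData 2 c) (q c) (a c) (p c)) :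
    ContinuousOn (fun z : BddSeq × ℝ × ℝ × ℝ => graphHeight (q z.1) z.2.1 z.2.2.1 z.2.2.2)
      (Metric.ball 0 1 ×ˢ region halfWidth) := by
  have hlt : ∀ z ∈ (Metric.ball (0 : BddSeq) 1 ×ˢ region halfWidth), ‖z.1‖ < 1 :=
    fun z hz => mem_ball_zero_iff.1 hz.1
  have hq : ∀ k, ContinuousOn (fun z : BddSeq × ℝ × ℝ × ℝ => (q z.1).coeff k z.2.2.2)
      (Metric.ball 0 1 ×ˢ region halfWidth) := by
    intro k
    have h := (jointlySmooth_formalSolution jointlySmooth_realData H k k le_rfl).1.2 0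
    simp only [iteratedDeriv_zero] at h
    exact h.comp (f := fun z : BddSeq × ℝ × ℝ × ℝ => (z.1, z.2.2.2)) (by fun_prop)
      fun z hz => ⟨mem_univ _, hz.2.1⟩
  have hw : ContinuousOn (fun z : BddSeq × ℝ × ℝ × ℝ =>
      seriesEval (primitive (q z.1)) z.2.1 z.2.2.2) (Metric.ball 0 1 ×ˢ region halfWidth) := by
    unfold seriesEval
    refine continuousOn_tsum (u := fun k => (1 / 2 : ℝ) ^ k) (fun k => ?_) summable_half
      fun k z hz => ?_
    · refine ContinuousOn.mul ?_ (by fun_prop)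
      rcases k with _ | k
      · simp only [coeff_primitive_zero]
        exact continuousOn_const
      · simp only [coeff_primitive_succ]
        exact (hq k).const_smul _
    · refine (FlatSolution.abs_coeff_primitive_mul_le (x := z.2.1) (t := z.2.2.2)
        ⟨hlt z hz, H z.1⟩ hz.2 k).trans ?_
      have : -z.2.2.2 / 512 ≤ 1 := by linarith [hz.2.1.1]
      exact mul_le_of_le_one_left (by positivity) this
  unfold graphHeight sqRadius
  fun_prop

theorem corollary1p5 :
    ∃ R : ℝ → ℝ, ContinuousOn R (Ioo (-1 : ℝ) 0) ∧ (∀ t ∈ Ioo (-1 : ℝ) 0, 0 < R t) ∧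
      Tendsto R (𝓝[<] 0) atTop ∧
      ∃ (E : Type) (_ : NormedAddCommGroup E) (_ : NormedSpace ℝ E) (P : Set E)
        (u : E → ℝ → ℝ → ℝ → ℝ),
        IsInfiniteDimensionalFamily R P u ∧
        ∀ c ∈ P, IsLocalGraphFlow R (u c) ∧
          (∀ t ∈ Ioo (-1 : ℝ) 0, ¬ IsProductSlice R (u c) t) ∧
          singularSet (cylGraph (u c)) (region R) = axis := by
  choose q a p H using fun c : BddSeq => exists_formalSolution (realData 2 c)
  have HF : ∀ c ∈ Metric.ball (0 : BddSeq) 1, FlatSolution c (q c) (a c) (p c) :=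
    fun c hc => ⟨mem_ball_zero_iff.1 hc, H c⟩
  refine ⟨halfWidth, continuousOn_halfWidth, fun t ht => halfWidth_pos ht.2, tendsto_halfWidth,
    BddSeq, inferInstance, inferInstance, Metric.ball 0 1, fun c => graphHeight (q c),
    ⟨inferInstance, not_finiteDimensional_bddSeq, Metric.isOpen_ball,
      ⟨0, Metric.mem_ball_self one_pos⟩, continuousOn_graphHeight H, ?_⟩,
    fun c hc => ⟨(HF c hc).isLocalGraphFlow, fun t ht => (HF c hc).not_isProductSlice ht,
      (HF c hc).singularSet_eq⟩⟩
  intro c hc c' hc' hne ε hε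
  by_contra hcon
  push Not at hcon
  exact hne (eq_of_realData_eq hε fun t ht hεt =>
    (HF c hc).realData_eq_of_slice_eq (HF c' hc') ht (hcon t ht hεt))
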